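/- Let $p$ be a prime with $p\equiv 1$ or $9\pmod{40}$. Then there are integers $c,d,x,y$ with $p=c^2+d^2=x^2+10y^2$. Moreover, let $c,d,x,y\in\mathbb Z$ be any integers with $p=c^2+d^2=x^2+10y^2$ and $c\equiv 1\pmod 4$, and suppose that $d=2^rd_0$ with $r\ge 0$ and $d_0$ integers and $d_0\equiv 1\pmod 4$. Assume that $\gcd(c,x+d)=1$ or $\gcd(d_0,x+c)=1$. Then $4\mid d$, $2\mid x-1$, $2\mid y$, $p\nmid d$, $5\nmid x$, and $$(-5)^{\frac{p-1}8}\equiv\begin{cases}\pm(-1)^{\frac d4+\frac{x-1}2+\frac y2}\pmod p&\text{if }\frac{2c-d}x\equiv\pm2\pmod 5,\\[2pt] \pm(-1)^{\frac d4+\frac{x-1}2+\frac y2}\,\frac cd\pmod p&\text{if }\frac{2c-d}x\equiv\pm1\pmod 5,\end{cases}$$ where in each line the same sign is taken on both sides, and the fractions $\frac cd$ and $\frac{2c-d}x$ are residue classes modulo $p$ and modulo $5$ respectively. -/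

import Mathlib

/-- Five is prime; this makes `ZMod 5` a field, so that `(2c - d)/x mod 5` is a genuine quotient. -/
instance fact_prime_five : Fact (Nat.Prime 5) := ⟨by norm_num⟩

/-! Put π = c + di, and let χ(n) in ℤ/4 be the exponent of the quartic residue symbol of n modulo π.
Raising x² ≡ -10y² (mod p) to the power (p-1)/8 expresses the octic symbol of -5 through χ(x) - χ(y)
and 2^((p-1)/8). The latter is elementary (`two_pow_eq`), so everything rests on χ(x) - χ(y).

The tool is rational quartic reciprocity (`chi_signedNat`): for odd n prime to p, normalised to be 1
mod 4, χ(n) is the quartic symbol of π modulo n. It comes from a quartic Gauss sum taken in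
characteristic ℓ: its fourth power is π³π̄, because the Jacobi sum J(χ,χ) is ±π, and Frobenius gives
its ℓ-th power.

To compare x with y, write c + (x+d)i = g(f + ei) with e, f coprime, y = 2^s y₀ with y₀ odd, Y₀g =
y₀², and W = (f + ei)/(1+i), of odd norm N. The two representations of p give gN = xe + 5·4^s·Y₀, so
xe ≡ -5·4^s·Y₀ modulo W. Taking quartic symbols modulo W and applying reciprocity to each factor
(`chi_sub_chi`): modulo x, W is π up to 1+i and rational factors; modulo e, f + ei is rational;
modulo a prime dividing y, c² + d² ≡ x², and the rational parametrisation of the circle makes c +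
(x+d)i a square root of iπ as far as symbols are concerned (`two_mul_quarticSymbol`,
`quarticJacobi_descent`). What survives is the symbol of c + (x+d)i modulo 5, which is governed by
the class of (2c-d)/x. Sign changes of x and d reduce to x ≡ 1 (mod 4) and to g prime to 5. -/

section QuarticLog

/-! ### Discrete logarithms of fourth roots of unity. -/

variable {K : Type*} [Field K] {ζ : K}

theorem pow_four_eq_one_of_mul_self (hζ : ζ * ζ = -1) : ζ ^ 4 = 1 := by
  linear_combination (ζ * ζ - 1) * hζ

theorem pow_val_add (hζ : ζ * ζ = -1) (j k : ZMod 4) :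
    ζ ^ (j + k).val = ζ ^ j.val * ζ ^ k.val := by
  rw [ZMod.val_add, ← pow_add, ← pow_eq_pow_mod _ (pow_four_eq_one_of_mul_self hζ)]

theorem pow_val_natCast (hζ : ζ * ζ = -1) (n : ℕ) : ζ ^ (n : ZMod 4).val = ζ ^ n := by
  rw [ZMod.val_natCast, ← pow_eq_pow_mod _ (pow_four_eq_one_of_mul_self hζ)]

theorem pow_val_intCast (hζ : ζ * ζ = -1) (n : ℤ) : ζ ^ (n : ZMod 4).val = ζ ^ n := by
  have h0 : ζ ≠ 0 := by rintro rfl; simp at hζ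
  have h4 : ζ ^ (4 : ℤ) = 1 := by exact_mod_cast pow_four_eq_one_of_mul_self hζ
  rw [← zpow_natCast, ZMod.val_intCast]
  conv_rhs => rw [← Int.emod_add_mul_ediv n 4, zpow_add₀ h0, zpow_mul, h4, one_zpow, mul_one]
  rfl

theorem pow_val_injective (hζ : ζ * ζ = -1) (h2 : (2 : K) ≠ 0) :
    Function.Injective fun j : ZMod 4 => ζ ^ j.val := by
  have h0 : ζ ≠ 0 := by rintro rfl; simp at hζ
  have key : ∀ j : ZMod 4, ζ ^ j.val = 1 → j = 0 := by
    have hm : (-1 : K) ≠ 1 := fun h => h2 (by linear_combination -h)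
    have h1 : ζ ≠ 1 := by rintro rfl; exact hm (by simpa using hζ.symm)
    have h3 : ζ ^ 3 ≠ 1 := fun h => h1 (by
      have := pow_four_eq_one_of_mul_self hζ
      linear_combination this - ζ * h)
    intro j hj
    fin_cases j
    · rfl
    · exact absurd ((pow_one ζ).symm.trans hj) h1
    · refine absurd ?_ hm
      rw [← hζ, ← pow_two]
      exact hj
    · exact absurd hj h3
  intro j k h
  have h' : ζ ^ j.val = ζ ^ k.val := h
  have := pow_val_add hζ (j - k) k
  rw [sub_add_cancel, h'] at this
  have h1 : ζ ^ (j - k).val = 1 := by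
    have hk : ζ ^ k.val ≠ 0 := pow_ne_zero _ h0
    exact (mul_right_cancel₀ hk (by rw [one_mul]; exact this)).symm
  exact sub_eq_zero.mp (key _ h1)

theorem exists_pow_val_eq (hζ : ζ * ζ = -1) {y : K} (hy : y ^ 4 = 1) :
    ∃ j : ZMod 4, ζ ^ j.val = y := by
  have : (y - 1) * ((y + 1) * ((y - ζ) * (y + ζ))) = 0 := by
    linear_combination hy + (1 - y ^ 2) * hζ
  rcases mul_eq_zero.mp this with h | h
  · exact ⟨0, by simpa using (sub_eq_zero.mp h).symm⟩
  rcases mul_eq_zero.mp h with h | h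
  · exact ⟨2, by rw [show (2 : ZMod 4).val = 2 from rfl]; linear_combination hζ - h⟩
  rcases mul_eq_zero.mp h with h | h
  · exact ⟨1, by rw [show (1 : ZMod 4).val = 1 from rfl]; linear_combination -h⟩
  · exact ⟨3, by rw [show (3 : ZMod 4).val = 3 from rfl]; linear_combination ζ * hζ - h⟩

open Classical in
/-- The discrete logarithm, in `ZMod 4`, of a fourth root of unity to the base `ζ` with
`ζ * ζ = -1`. -/
noncomputable def quarticLog {K : Type*} [Field K] (ζ y : K) : ZMod 4 :=
  if h : ∃ j : ZMod 4, ζ ^ j.val = y then h.choose else 0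

theorem pow_quarticLog (hζ : ζ * ζ = -1) {y : K} (hy : y ^ 4 = 1) :
    ζ ^ (quarticLog ζ y).val = y := by
  have h := exists_pow_val_eq hζ hy
  rw [quarticLog, dif_pos h]
  exact h.choose_spec

theorem quarticLog_pow_val (hζ : ζ * ζ = -1) (h2 : (2 : K) ≠ 0) (j : ZMod 4) :
    quarticLog ζ (ζ ^ j.val) = j := by
  have h : ∃ k : ZMod 4, ζ ^ k.val = ζ ^ j.val := ⟨j, rfl⟩
  rw [quarticLog, dif_pos h]
  exact pow_val_injective hζ h2 h.choose_spec

theorem quarticLog_eq (hζ : ζ * ζ = -1) (h2 : (2 : K) ≠ 0) {y : K} {j : ZMod 4}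
    (h : ζ ^ j.val = y) : quarticLog ζ y = j := by
  rw [← h, quarticLog_pow_val hζ h2]

theorem quarticLog_mul (hζ : ζ * ζ = -1) (h2 : (2 : K) ≠ 0) {y z : K} (hy : y ^ 4 = 1)
    (hz : z ^ 4 = 1) : quarticLog ζ (y * z) = quarticLog ζ y + quarticLog ζ z :=
  quarticLog_eq hζ h2 (by rw [pow_val_add hζ, pow_quarticLog hζ hy, pow_quarticLog hζ hz])

theorem quarticLog_zpow (hζ : ζ * ζ = -1) (h2 : (2 : K) ≠ 0) (n : ℤ) :
    quarticLog ζ (ζ ^ n) = n :=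
  quarticLog_eq hζ h2 (pow_val_intCast hζ n)

theorem quarticLog_one (hζ : ζ * ζ = -1) (h2 : (2 : K) ≠ 0) : quarticLog ζ 1 = 0 :=
  quarticLog_eq hζ h2 (by simp)

end QuarticLog

/-! ### The quartic character modulo a split prime and its Jacobi sum. -/

/-- Evaluation of Gaussian integers at a square root of `-1`. -/
noncomputable def GaussianInt.eval {K : Type*} [CommRing K] (ζ : K) (hζ : ζ * ζ = -1) :
    GaussianInt →+* K :=
  Zsqrtd.lift ⟨ζ, by rw [hζ]; push_cast; ring⟩

theorem GaussianInt.eval_apply {K : Type*} [CommRing K] {ζ : K} (hζ : ζ * ζ = -1)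
    (α : GaussianInt) : GaussianInt.eval ζ hζ α = α.re + α.im * ζ := by
  simp [GaussianInt.eval]

/-- A Gaussian prime `a + b i` of prime norm `p`, normalised so that `b` is even. -/
structure SplitPrime where
  p : ℕ
  fact : Fact p.Prime
  a : ℤ
  b : ℤ
  norm_eq : (p : ℤ) = a ^ 2 + b ^ 2
  even : 2 ∣ b

namespace SplitPrime

variable (π : SplitPrime)

instance : Fact π.p.Prime := π.fact

/-- The underlying Gaussian integer. -/
def val : GaussianInt := ⟨π.a, π.b⟩

theorem odd_a : π.a % 2 = 1 := by
  obtain ⟨k, hk⟩ := π.even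
  rcases Int.emod_two_eq_zero_or_one π.a with h | h
  · obtain ⟨m, hm⟩ := Int.dvd_of_emod_eq_zero h
    have h4 : (4 : ℤ) ∣ π.p := ⟨m ^ 2 + k ^ 2, by rw [π.norm_eq, hm, hk]; ring⟩
    have h4' : 4 ∣ π.p := by exact_mod_cast h4
    have h2 : 2 ∣ π.p := dvd_trans (by norm_num) h4'
    rw [(Nat.prime_dvd_prime_iff_eq Nat.prime_two π.fact.out).mp h2 |>.symm] at h4'
    omega
  · exact h

theorem p_mod_four : π.p % 4 = 1 := by
  obtain ⟨k, hk⟩ := π.even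
  have h := π.norm_eq
  have ha := π.odd_a
  obtain ⟨m, hm⟩ : ∃ m, π.a = 2 * m + 1 := ⟨π.a / 2, by omega⟩
  have : (π.p : ℤ) = 4 * (m ^ 2 + m + k ^ 2) + 1 := by rw [h, hk, hm]; ring
  omega

theorem two_ne_zero : (2 : ZMod π.p) ≠ 0 := by
  have h := π.p_mod_four
  intro h2
  have h3 : ((2 : ℕ) : ZMod π.p) = 0 := by exact_mod_cast h2
  have := (ZMod.natCast_eq_zero_iff 2 π.p).mp h3
  have := Nat.le_of_dvd (by norm_num) this
  have := π.fact.out.two_le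
  omega

theorem b_ne_zero : (π.b : ZMod π.p) ≠ 0 := by
  intro hb
  have h : ((π.p : ℤ) : ZMod π.p) = ((π.a ^ 2 + π.b ^ 2 : ℤ) : ZMod π.p) := by rw [← π.norm_eq]
  push_cast at h
  rw [hb, CharP.cast_eq_zero] at h
  have ha : (π.a : ZMod π.p) = 0 := by
    have : (π.a : ZMod π.p) ^ 2 = 0 := by linear_combination -h
    exact pow_eq_zero_iff (by norm_num) |>.mp this
  obtain ⟨m, hm⟩ := (ZMod.intCast_zmod_eq_zero_iff_dvd _ _).mp ha
  obtain ⟨n, hn⟩ := (ZMod.intCast_zmod_eq_zero_iff_dvd _ _).mp hb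
  have hp := π.fact.out.two_le
  have h0 : (π.p : ℤ) ≠ 0 := by positivity
  have h1 : (π.p : ℤ) * (m ^ 2 + n ^ 2) = 1 := mul_left_cancel₀ h0 (by
    have := π.norm_eq
    rw [hm, hn] at this
    linear_combination -this)
  have := Int.eq_one_or_neg_one_of_mul_eq_one h1
  omega

/-- The image of `i` in the residue field of the prime. -/
noncomputable def imag : ZMod π.p := -(π.a : ZMod π.p) / π.b

theorem a_add_b_mul_imag : (π.a : ZMod π.p) + π.b * π.imag = 0 := by
  rw [imag, mul_div_cancel₀ _ π.b_ne_zero]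
  ring

theorem imag_mul_self : π.imag * π.imag = -1 := by
  have h : ((π.p : ℤ) : ZMod π.p) = ((π.a ^ 2 + π.b ^ 2 : ℤ) : ZMod π.p) := by rw [← π.norm_eq]
  push_cast at h
  rw [CharP.cast_eq_zero] at h
  have hb := π.b_ne_zero
  rw [imag]
  field_simp
  linear_combination -h

/-- The exponent of the quartic residue symbol of a rational integer modulo a split prime. -/
noncomputable def chi (n : ℤ) : ZMod 4 :=
  quarticLog π.imag ((n : ZMod π.p) ^ ((π.p - 1) / 4))

variable {π}

theorem pow_pow_four {n : ZMod π.p} (h : n ≠ 0) : (n ^ ((π.p - 1) / 4)) ^ 4 = 1 := by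
  rw [← pow_mul, Nat.div_mul_cancel (by have := π.p_mod_four; omega)]
  exact ZMod.pow_card_sub_one_eq_one h

variable (π) in
theorem imag_pow_quarticLog {n : ZMod π.p} (h : n ≠ 0) :
    π.imag ^ (quarticLog π.imag (n ^ ((π.p - 1) / 4))).val = n ^ ((π.p - 1) / 4) :=
  pow_quarticLog π.imag_mul_self (pow_pow_four h)

theorem imag_pow_chi {n : ℤ} (h : (n : ZMod π.p) ≠ 0) :
    π.imag ^ (π.chi n).val = (n : ZMod π.p) ^ ((π.p - 1) / 4) :=
  imag_pow_quarticLog π h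

theorem chi_mul {m n : ℤ} (hm : (m : ZMod π.p) ≠ 0) (hn : (n : ZMod π.p) ≠ 0) :
    π.chi (m * n) = π.chi m + π.chi n := by
  rw [chi, Int.cast_mul, mul_pow,
    quarticLog_mul π.imag_mul_self π.two_ne_zero (pow_pow_four hm) (pow_pow_four hn)]
  rfl

theorem chi_one : π.chi 1 = 0 := by
  rw [chi, Int.cast_one, one_pow, quarticLog_one π.imag_mul_self π.two_ne_zero]

theorem chi_pow {m : ℤ} (hm : (m : ZMod π.p) ≠ 0) (k : ℕ) : π.chi (m ^ k) = k * π.chi m := by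
  induction k with
  | zero => simp [chi_one]
  | succ k ih =>
    rw [pow_succ, chi_mul (by push_cast; exact pow_ne_zero _ hm) hm, ih]
    push_cast
    ring

theorem chi_congr {m n : ℤ} (h : (m : ZMod π.p) = n) : π.chi m = π.chi n := by
  rw [chi, chi, h]

theorem chi_neg_one : π.chi (-1) = 2 * ((π.p - 1) / 4 : ℕ) := by
  refine quarticLog_eq π.imag_mul_self π.two_ne_zero ?_
  have h : (2 * (((π.p - 1) / 4 : ℕ) : ZMod 4)) = ((2 * ((π.p - 1) / 4) : ℕ) : ZMod 4) := by
    push_cast; rfl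
  rw [h, pow_val_natCast π.imag_mul_self, pow_mul, pow_two, π.imag_mul_self]
  push_cast
  rfl

variable (π)

open Classical in
/-- The quartic residue symbol modulo a split prime, as a multiplicative character with values in
the Gaussian integers. -/
noncomputable def mulChar : MulChar (ZMod π.p) GaussianInt where
  toFun n := if n = 0 then 0 else
    (⟨0, 1⟩ : GaussianInt) ^ (quarticLog π.imag (n ^ ((π.p - 1) / 4))).val
  map_one' := by
    rw [if_neg one_ne_zero, one_pow, quarticLog_one π.imag_mul_self π.two_ne_zero]
    simp
  map_mul' m n := by
    by_cases hm : m = 0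
    · simp [hm]
    by_cases hn : n = 0
    · simp [hn]
    rw [if_neg (mul_ne_zero hm hn), if_neg hm, if_neg hn, mul_pow,
      quarticLog_mul π.imag_mul_self π.two_ne_zero (pow_pow_four hm) (pow_pow_four hn),
      ZMod.val_add, ← pow_add]
    exact (pow_eq_pow_mod _ (by decide)).symm
  map_nonunit' n hn := by
    rw [if_pos]
    by_contra h
    exact hn (isUnit_iff_ne_zero.mpr h)

theorem mulChar_apply {n : ZMod π.p} (hn : n ≠ 0) :
    π.mulChar n = (⟨0, 1⟩ : GaussianInt) ^ (quarticLog π.imag (n ^ ((π.p - 1) / 4))).val :=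
  if_neg hn

theorem eval_mulChar (n : ZMod π.p) :
    GaussianInt.eval π.imag π.imag_mul_self (π.mulChar n) = n ^ ((π.p - 1) / 4) := by
  by_cases hn : n = 0
  · have := π.p_mod_four
    have := π.fact.out.two_le
    rw [hn, MulChar.map_zero, map_zero, zero_pow (by omega)]
  · rw [mulChar_apply π hn, map_pow, GaussianInt.eval_apply]
    simp only [Int.cast_zero, Int.cast_one, zero_add, one_mul]
    exact pow_quarticLog π.imag_mul_self (pow_pow_four hn)

/-- Modulo π the character is n ↦ n^k with k = (p-1)/4, so the sum becomes a combination of power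
sums of exponent at most 2k < p-1, all of which vanish. Hence π divides the Jacobi sum. -/
theorem eval_jacobiSum :
    GaussianInt.eval π.imag π.imag_mul_self (jacobiSum π.mulChar π.mulChar) = 0 := by
  have h4 := π.p_mod_four
  have h2 := π.fact.out.two_le
  set k := (π.p - 1) / 4 with hk
  rw [jacobiSum, map_sum]
  simp only [map_mul, eval_mulChar, ← hk]
  have hx : ∀ x : ZMod π.p, x ^ k * (1 - x) ^ k =
      ∑ i ∈ Finset.range (k + 1), ((-1) ^ i * (k.choose i : ZMod π.p)) * x ^ (k + i) := by
    intro x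
    rw [show (1 - x) = -x + 1 by ring, add_pow, Finset.mul_sum]
    refine Finset.sum_congr rfl fun i _ => ?_
    rw [neg_pow, one_pow, pow_add]
    ring
  simp only [hx]
  rw [Finset.sum_comm]
  refine Finset.sum_eq_zero fun i hi => ?_
  have hi' : i ≤ k := by simpa [Nat.lt_succ_iff] using hi
  rw [← Finset.mul_sum, FiniteField.sum_pow_lt_card_sub_one, mul_zero]
  rw [ZMod.card]
  omega

/-- Any quadratic nonresidue works, by Euler's criterion. -/
theorem exists_mulChar_sq_ne_one : ∃ n : ZMod π.p, n ≠ 0 ∧ π.mulChar n ^ 2 = -1 := by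
  have h4 := π.p_mod_four
  have hp := π.fact.out.two_le
  have hchar : ringChar (ZMod π.p) ≠ 2 := by
    rw [ZMod.ringChar_zmod_n]; omega
  obtain ⟨n, hn⟩ := FiniteField.exists_nonsquare (F := ZMod π.p) hchar
  have hn0 : n ≠ 0 := by rintro rfl; exact hn ⟨0, by simp⟩
  refine ⟨n, hn0, ?_⟩
  have h := (FiniteField.pow_dichotomy hchar hn0).resolve_left
    (fun h => hn ((FiniteField.isSquare_iff hchar hn0).mpr h))
  rw [ZMod.card] at h
  have hm : π.p / 2 = (π.p - 1) / 4 * 2 := by omega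
  rw [hm, pow_mul, ← imag_pow_quarticLog π hn0] at h
  rw [mulChar_apply π hn0]
  generalize quarticLog π.imag (n ^ ((π.p - 1) / 4)) = j at h ⊢
  have h2 := π.two_ne_zero
  have hI := π.imag_mul_self
  fin_cases j
  · exfalso
    change (π.imag ^ 0) ^ 2 = -1 at h
    exact h2 (by linear_combination h)
  · decide
  · exfalso
    change (π.imag ^ 2) ^ 2 = -1 at h
    exact h2 (by linear_combination h - (π.imag ^ 2 - 1) * hI)
  · decide

theorem mulChar_sq_ne_one : π.mulChar * π.mulChar ≠ 1 := by
  obtain ⟨n, hn0, hn⟩ := π.exists_mulChar_sq_ne_one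
  intro h
  have := congrArg (fun χ => χ n) h
  simp only [MulChar.mul_apply, MulChar.one_apply (isUnit_iff_ne_zero.mpr hn0)] at this
  rw [← pow_two, hn] at this
  exact absurd this (by decide)

theorem mulChar_ne_one : π.mulChar ≠ 1 := by
  intro h
  exact π.mulChar_sq_ne_one (by rw [h, one_mul])

theorem mulChar_pow_four : π.mulChar ^ 4 = 1 := by
  refine MulChar.ext fun n => ?_
  rw [MulChar.pow_apply' _ (by norm_num), mulChar_apply π n.ne_zero, ← pow_mul, mul_comm, pow_mul,
    show (⟨0, 1⟩ : GaussianInt) ^ 4 = 1 by decide, one_pow]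
  simp

theorem mulChar_inv : π.mulChar⁻¹ = π.mulChar.ringHomComp (starRingEnd GaussianInt) := by
  refine (eq_inv_of_mul_eq_one_right ?_).symm
  refine MulChar.ext fun n => ?_
  rw [MulChar.mul_apply, MulChar.ringHomComp_apply, mulChar_apply π n.ne_zero, map_pow, ← mul_pow,
    show (⟨0, 1⟩ : GaussianInt) * (starRingEnd GaussianInt) ⟨0, 1⟩ = 1 by decide, one_pow]
  simp

/-- The identity J(χ,χ)J(χ⁻¹,χ⁻¹) = p is applied over ℂ and pulled back along the embedding;
inverting χ conjugates J, since the values are powers of i. -/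
theorem norm_jacobiSum : (jacobiSum π.mulChar π.mulChar).norm = π.p := by
  have hne : ∀ χ : MulChar (ZMod π.p) GaussianInt, χ ≠ 1 →
      χ.ringHomComp GaussianInt.toComplex ≠ 1 := fun χ h =>
    (MulChar.ringHomComp_ne_one_iff GaussianInt.toComplex_injective).mpr h
  have h := jacobiSum_mul_jacobiSum_inv (F := ZMod π.p) (F' := ℂ)
    (χ := π.mulChar.ringHomComp GaussianInt.toComplex)
    (φ := π.mulChar.ringHomComp GaussianInt.toComplex) ?_ (hne _ π.mulChar_ne_one)
    (hne _ π.mulChar_ne_one) ?_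
  · rw [MulChar.ringHomComp_inv, mulChar_inv, jacobiSum_ringHomComp, jacobiSum_ringHomComp,
      jacobiSum_ringHomComp, ← map_mul, ZMod.card] at h
    have h' : GaussianInt.toComplex (jacobiSum π.mulChar π.mulChar *
        (starRingEnd GaussianInt) (jacobiSum π.mulChar π.mulChar)) =
        GaussianInt.toComplex (π.p : GaussianInt) := by rw [h]; simp
    have := GaussianInt.toComplex_injective h'
    have h3 := Zsqrtd.norm_eq_mul_conj (jacobiSum π.mulChar π.mulChar)
    rw [starRingEnd_apply] at this
    rw [this] at h3
    exact_mod_cast h3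
  · rw [ZMod.ringChar_zmod_n, ringChar.eq_zero]
    exact π.fact.out.ne_zero.symm
  · rw [← MulChar.ringHomComp_mul]
    exact hne _ π.mulChar_sq_ne_one

theorem isPrimitiveRoot_i : IsPrimitiveRoot (⟨0, 1⟩ : GaussianInt) 4 := by
  rw [IsPrimitiveRoot.iff (by norm_num)]
  refine ⟨by decide, fun l hl hl4 => ?_⟩
  interval_cases l <;> decide

/-- J ≡ -1 modulo (i-1)² = -2i. This congruence is what later excludes the associates ±iπ. -/
theorem two_dvd_im_jacobiSum : 2 ∣ (jacobiSum π.mulChar π.mulChar).im := by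
  obtain ⟨z, -, hz⟩ := exists_jacobiSum_eq_neg_one_add (n := 4) (by norm_num)
    π.mulChar_pow_four π.mulChar_pow_four
    (by rw [ZMod.card]; have := π.p_mod_four; omega) isPrimitiveRoot_i
  rw [hz, show ((⟨0, 1⟩ : GaussianInt) - 1) ^ 2 = ⟨0, -2⟩ by decide]
  refine ⟨-z.re, ?_⟩
  simp [Zsqrtd.im_mul]
  ring

/-- The quartic Jacobi sum is, up to sign, the prime itself. -/
theorem jacobiSum_eq : jacobiSum π.mulChar π.mulChar = π.val ∨
    jacobiSum π.mulChar π.mulChar = -π.val := by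
  set J := jacobiSum π.mulChar π.mulChar with hJ
  have hn : J.re ^ 2 + J.im ^ 2 = (π.p : ℤ) := by
    rw [← π.norm_jacobiSum, Zsqrtd.norm_def]; ring
  have h0 := π.eval_jacobiSum
  rw [← hJ, GaussianInt.eval_apply] at h0
  have h1 := π.a_add_b_mul_imag
  have hp := π.norm_eq
  have hd : (π.p : ℤ) ∣ J.im * π.a - J.re * π.b := by
    rw [← ZMod.intCast_zmod_eq_zero_iff_dvd]
    push_cast
    linear_combination (J.im : ZMod π.p) * h1 - (π.b : ZMod π.p) * h0
  obtain ⟨k, hk⟩ := hd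
  have hp0 : (π.p : ℤ) ≠ 0 := by exact_mod_cast π.fact.out.ne_zero
  have hsum : (J.re * π.a + J.im * π.b) ^ 2 + (J.im * π.a - J.re * π.b) ^ 2 = (π.p : ℤ) ^ 2 := by
    rw [pow_two (π.p : ℤ)]
    nth_rw 1 [← hn]
    rw [hp]
    ring
  have hodd : (J.re * π.a + J.im * π.b) % 2 = 1 := by
    have ha := π.odd_a
    obtain ⟨m, hm⟩ := π.even
    obtain ⟨n, hn2⟩ := π.two_dvd_im_jacobiSum
    rw [← hJ] at hn2
    have hr : J.re % 2 = 1 := by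
      by_contra hr
      obtain ⟨q, hq⟩ : ∃ q, J.re = 2 * q := ⟨J.re / 2, by omega⟩
      have h4 := π.p_mod_four
      have : (π.p : ℤ) = 4 * (q ^ 2 + n ^ 2) := by rw [← hn, hq, hn2]; ring
      omega
    rw [hm]
    have h3 : (J.re * π.a) % 2 = 1 := by rw [Int.mul_emod, hr, ha]; rfl
    have : J.im * (2 * m) = 2 * (J.im * m) := by ring
    omega
  -- Otherwise the imaginary part alone uses up the norm p², and the odd real part would be 0.
  have hk0 : k = 0 := by
    by_contra hk0
    have hk1 : 1 ≤ k ^ 2 := by have := sq_nonneg k; have : k ^ 2 ≠ 0 := by positivity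
                               omega
    rw [hk] at hsum
    have h5 : (J.re * π.a + J.im * π.b) ^ 2 ≤ 0 := by nlinarith [sq_nonneg (π.p : ℤ)]
    have h6 : J.re * π.a + J.im * π.b = 0 := by
      have := sq_nonneg (J.re * π.a + J.im * π.b)
      exact pow_eq_zero_iff (n := 2) (by norm_num) |>.mp (by omega)
    omega
  rw [hk0, mul_zero] at hk
  rw [hk] at hsum
  have hz : (0 : ℤ) ^ 2 = 0 := by norm_num
  rw [hz, add_zero] at hsum
  rcases sq_eq_sq_iff_eq_or_eq_neg.mp hsum with h | h
  · left
    apply Zsqrtd.ext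
    · exact mul_left_cancel₀ hp0 (by simp only [val]; linear_combination (-J.re) * (-hp) + π.a * h - π.b * hk)
    · exact mul_left_cancel₀ hp0 (by simp only [val]; linear_combination (-J.im) * (-hp) + π.b * h + π.a * hk)
  · right
    apply Zsqrtd.ext
    · exact mul_left_cancel₀ hp0 (by simp only [val, Zsqrtd.re_neg]; linear_combination (-J.re) * (-hp) + π.a * h - π.b * hk)
    · exact mul_left_cancel₀ hp0 (by simp only [val, Zsqrtd.im_neg]; linear_combination (-J.im) * (-hp) + π.b * h + π.a * hk)

end SplitPrime

/-! ### The quartic symbol of a Gaussian integer modulo an odd rational prime. -/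

/-- The prime `ℓ` does not divide the norm of `α`. -/
def CoprimeNorm (ℓ : ℕ) (α : GaussianInt) : Prop := ¬ (ℓ : ℤ) ∣ α.norm

section ResidueSymbol

variable (ℓ : ℕ) [Fact ℓ.Prime]

/-- A square root of `-1` in the algebraic closure of the prime field. -/
noncomputable def rootNegOne : AlgebraicClosure (ZMod ℓ) :=
  (IsAlgClosed.exists_pow_nat_eq (-1 : AlgebraicClosure (ZMod ℓ)) (n := 2) (by norm_num)).choose

theorem rootNegOne_mul_self : rootNegOne ℓ * rootNegOne ℓ = -1 := by
  rw [← pow_two]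
  exact (IsAlgClosed.exists_pow_nat_eq (-1 : AlgebraicClosure (ZMod ℓ)) (n := 2)
    (by norm_num)).choose_spec

/-- Reduction of Gaussian integers in characteristic `ℓ`. -/
noncomputable def redHom : GaussianInt →+* AlgebraicClosure (ZMod ℓ) :=
  GaussianInt.eval (rootNegOne ℓ) (rootNegOne_mul_self ℓ)

theorem redHom_apply (α : GaussianInt) : redHom ℓ α = α.re + α.im * rootNegOne ℓ :=
  GaussianInt.eval_apply _ α

theorem redHom_I : redHom ℓ ⟨0, 1⟩ = rootNegOne ℓ := by
  simp [redHom_apply]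

theorem two_ne_zero_of_odd {ℓ : ℕ} [Fact ℓ.Prime] (h : ℓ ≠ 2) :
    (2 : AlgebraicClosure (ZMod ℓ)) ≠ 0 := by
  intro h2
  have : ((2 : ℕ) : AlgebraicClosure (ZMod ℓ)) = 0 := by exact_mod_cast h2
  rw [CharP.cast_eq_zero_iff _ ℓ] at this
  exact h ((Nat.prime_dvd_prime_iff_eq Fact.out Nat.prime_two).mp this)

/-- The odd number `n` with the sign that makes it `1` modulo `4`. -/
def signedNat (n : ℕ) : ℤ := ZMod.χ₄ n * n

theorem signedNat_mul (m n : ℕ) : signedNat (m * n) = signedNat m * signedNat n := by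
  simp only [signedNat, Nat.cast_mul, map_mul]
  ring

theorem signedNat_cases {n : ℕ} (hn : n % 2 = 1) :
    (n % 4 = 1 ∧ signedNat n = n) ∨ (n % 4 = 3 ∧ signedNat n = -n) := by
  rcases (by omega : n % 4 = 1 ∨ n % 4 = 3) with h | h
  · left; refine ⟨h, ?_⟩; rw [signedNat, ZMod.χ₄_nat_one_mod_four h, one_mul]
  · right; refine ⟨h, ?_⟩; rw [signedNat, ZMod.χ₄_nat_three_mod_four h, neg_one_mul]

theorem signedNat_mod_four {n : ℕ} (hn : n % 2 = 1) : signedNat n % 4 = 1 := by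
  rcases signedNat_cases hn with ⟨h, e⟩ | ⟨h, e⟩ <;> omega

theorem signedNat_natAbs {n : ℤ} (hn : n % 4 = 1) : signedNat n.natAbs = n := by
  rcases signedNat_cases (n := n.natAbs) (by omega) with ⟨h, e⟩ | ⟨h, e⟩ <;> omega

theorem rootNegOne_pow {ℓ : ℕ} [Fact ℓ.Prime] (h : ℓ ≠ 2) :
    rootNegOne ℓ ^ ℓ = ZMod.χ₄ ℓ * rootNegOne ℓ := by
  have ho := (Fact.out : ℓ.Prime).eq_two_or_odd.resolve_left h
  have hz := rootNegOne_mul_self ℓ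
  rw [pow_eq_pow_mod _ (pow_four_eq_one_of_mul_self hz)]
  rcases (by omega : ℓ % 4 = 1 ∨ ℓ % 4 = 3) with h | h
  · rw [ZMod.χ₄_nat_one_mod_four h, h]; simp
  · rw [ZMod.χ₄_nat_three_mod_four h, h]; push_cast; linear_combination rootNegOne ℓ * hz

/-- Frobenius fixes rational integers and multiplies i by ±1 according to ℓ mod 4: it acts as the
identity or as conjugation. -/
theorem redHom_pow {ℓ : ℕ} [Fact ℓ.Prime] (h : ℓ ≠ 2) (α : GaussianInt) :
    redHom ℓ α ^ ℓ = α.re + α.im * (ZMod.χ₄ ℓ * rootNegOne ℓ) := by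
  rw [redHom_apply, add_pow_char, mul_pow, rootNegOne_pow h]
  have hi : ∀ n : ℤ, (n : AlgebraicClosure (ZMod ℓ)) ^ ℓ = n := by
    intro n
    have := congrArg (algebraMap (ZMod ℓ) (AlgebraicClosure (ZMod ℓ))) (ZMod.pow_card (n : ZMod ℓ))
    rwa [map_pow, map_intCast] at this
  rw [hi, hi]

theorem redHom_pow_of_one {ℓ : ℕ} [Fact ℓ.Prime] (h : ℓ % 4 = 1) (α : GaussianInt) :
    redHom ℓ α ^ ℓ = redHom ℓ α := by
  rw [redHom_pow (by omega), redHom_apply, ZMod.χ₄_nat_one_mod_four h]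
  simp

theorem redHom_pow_of_three {ℓ : ℕ} [Fact ℓ.Prime] (h : ℓ % 4 = 3) (α : GaussianInt) :
    redHom ℓ α ^ ℓ = redHom ℓ (star α) := by
  rw [redHom_pow (by omega), redHom_apply, ZMod.χ₄_nat_three_mod_four h]
  simp

variable {ℓ}

theorem redHom_mul_star (α : GaussianInt) : redHom ℓ α * redHom ℓ (star α) = (α.norm : ℤ) := by
  rw [← map_mul, ← Zsqrtd.norm_eq_mul_conj]
  simp

theorem intCast_ne_zero_iff {n : ℤ} :
    (n : AlgebraicClosure (ZMod ℓ)) ≠ 0 ↔ ¬ (ℓ : ℤ) ∣ n := by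
  rw [Ne, CharP.intCast_eq_zero_iff _ ℓ]

theorem CoprimeNorm.left {α : GaussianInt} (h : CoprimeNorm ℓ α) : redHom ℓ α ≠ 0 := by
  intro h0
  have := redHom_mul_star (ℓ := ℓ) α
  rw [h0, zero_mul] at this
  exact intCast_ne_zero_iff.mpr h this.symm

theorem CoprimeNorm.right {α : GaussianInt} (h : CoprimeNorm ℓ α) : redHom ℓ (star α) ≠ 0 := by
  intro h0
  have := redHom_mul_star (ℓ := ℓ) α
  rw [h0, mul_zero] at this
  exact intCast_ne_zero_iff.mpr h this.symm

theorem CoprimeNorm.mul {α β : GaussianInt} (h : CoprimeNorm ℓ α) (h' : CoprimeNorm ℓ β) :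
    CoprimeNorm ℓ (α * β) := by
  rw [CoprimeNorm, Zsqrtd.norm_mul]
  intro hd
  rcases (Nat.prime_iff_prime_int.mp Fact.out).dvd_or_dvd hd with hd | hd
  exacts [h hd, h' hd]

variable (ℓ)

/-- The power of `α / ᾱ` that computes the quartic symbol of `α` modulo the rational prime `ℓ`. -/
noncomputable def twist (α : GaussianInt) : AlgebraicClosure (ZMod ℓ) :=
  (redHom ℓ α / redHom ℓ (star α)) ^ ((signedNat ℓ - 1) / 4)

/-- The exponent of the quartic residue symbol of `α` modulo the odd rational prime `ℓ`. -/
noncomputable def quarticSymbol (α : GaussianInt) : ZMod 4 :=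
  quarticLog (rootNegOne ℓ) (twist ℓ α)

variable {ℓ}

theorem twist_mul (α β : GaussianInt) : twist ℓ (α * β) = twist ℓ α * twist ℓ β := by
  rw [twist, twist, twist, ← mul_zpow, star_mul, map_mul, map_mul, mul_comm (redHom ℓ (star β)),
    mul_div_mul_comm]

/-- Four times the exponent is `signedNat ℓ - 1`. If ℓ ≡ 1 (mod 4), Frobenius fixes α/ᾱ; if ℓ ≡ 3,
it inverts it, and the sign in `signedNat ℓ = -ℓ` undoes this. -/
theorem twist_pow_four (hℓ : ℓ ≠ 2) {α : GaussianInt} (h : CoprimeNorm ℓ α) :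
    twist ℓ α ^ 4 = 1 := by
  have ho := (Fact.out : ℓ.Prime).eq_two_or_odd.resolve_left hℓ
  have h1 := h.left
  have h2 := h.right
  rw [twist, ← zpow_natCast, ← zpow_mul,
    show (signedNat ℓ - 1) / 4 * ((4 : ℕ) : ℤ) = signedNat ℓ - 1 by
      have := signedNat_mod_four ho; push_cast; omega]
  rw [zpow_sub₀ (div_ne_zero h1 h2), zpow_one, div_eq_one_iff_eq (div_ne_zero h1 h2)]
  rcases signedNat_cases ho with ⟨h4, e⟩ | ⟨h4, e⟩
  · rw [e, zpow_natCast, div_pow, redHom_pow_of_one h4, redHom_pow_of_one h4]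
  · rw [e, zpow_neg, zpow_natCast, div_pow, redHom_pow_of_three h4, redHom_pow_of_three h4,
      star_star, inv_div]

theorem quarticSymbol_mul (hℓ : ℓ ≠ 2) {α β : GaussianInt} (h : CoprimeNorm ℓ α)
    (h' : CoprimeNorm ℓ β) :
    quarticSymbol ℓ (α * β) = quarticSymbol ℓ α + quarticSymbol ℓ β := by
  rw [quarticSymbol, twist_mul, quarticLog_mul (rootNegOne_mul_self ℓ) (two_ne_zero_of_odd hℓ)
    (twist_pow_four hℓ h) (twist_pow_four hℓ h')]
  rfl

theorem quarticSymbol_congr {α β : GaussianInt} (hr : (ℓ : ℤ) ∣ α.re - β.re)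
    (hi : (ℓ : ℤ) ∣ α.im - β.im) : quarticSymbol ℓ α = quarticSymbol ℓ β := by
  have h1 : (α.re : AlgebraicClosure (ZMod ℓ)) = β.re := by
    rw [← sub_eq_zero, ← Int.cast_sub, CharP.intCast_eq_zero_iff _ ℓ]; exact hr
  have h2 : (α.im : AlgebraicClosure (ZMod ℓ)) = β.im := by
    rw [← sub_eq_zero, ← Int.cast_sub, CharP.intCast_eq_zero_iff _ ℓ]; exact hi
  simp only [quarticSymbol, twist, redHom_apply, Zsqrtd.re_star, Zsqrtd.im_star, Int.cast_neg, h1,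
    h2]

theorem quarticSymbol_intCast (hℓ : ℓ ≠ 2) {n : ℤ} (h : ¬ (ℓ : ℤ) ∣ n) :
    quarticSymbol ℓ n = 0 := by
  have h0 : (n : AlgebraicClosure (ZMod ℓ)) ≠ 0 := intCast_ne_zero_iff.mpr h
  rw [quarticSymbol, twist]
  simp only [redHom_apply, Zsqrtd.re_intCast, Zsqrtd.im_intCast, Zsqrtd.re_star, Zsqrtd.im_star,
    neg_zero, Int.cast_zero, zero_mul, add_zero]
  rw [div_self h0, one_zpow, quarticLog_one (rootNegOne_mul_self ℓ) (two_ne_zero_of_odd hℓ)]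

theorem rootNegOne_ne_zero : rootNegOne ℓ ≠ 0 := by
  intro h
  have := rootNegOne_mul_self ℓ
  rw [h] at this
  simp at this

/-- Because (1+i)/(1-i) = i. -/
theorem quarticSymbol_one_add_I (hℓ : ℓ ≠ 2) :
    quarticSymbol ℓ ⟨1, 1⟩ = ((signedNat ℓ - 1) / 4 : ℤ) := by
  have hz := rootNegOne_mul_self ℓ
  have h2 := two_ne_zero_of_odd hℓ
  have hne : 1 - rootNegOne ℓ ≠ 0 := by
    intro h
    apply h2
    linear_combination (1 + rootNegOne ℓ) * h + hz
  rw [quarticSymbol, twist, ← quarticLog_zpow hz h2]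
  congr 2
  simp only [redHom_apply, Zsqrtd.re_star, Zsqrtd.im_star, Int.cast_one, Int.cast_neg]
  have h3 : (1 : AlgebraicClosure (ZMod ℓ)) + -1 * rootNegOne ℓ = 1 - rootNegOne ℓ := by ring
  rw [h3, div_eq_iff hne]
  linear_combination hz

theorem quarticSymbol_I (hℓ : ℓ ≠ 2) :
    quarticSymbol ℓ ⟨0, 1⟩ = 2 * ((signedNat ℓ - 1) / 4 : ℤ) := by
  have hz := rootNegOne_mul_self ℓ
  have h2 := two_ne_zero_of_odd hℓ
  rw [quarticSymbol, twist, ← Int.cast_two, ← Int.cast_mul, ← quarticLog_zpow hz h2, zpow_mul]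
  congr 2
  have h0 := rootNegOne_ne_zero (ℓ := ℓ)
  simp only [redHom_apply, Zsqrtd.re_star, Zsqrtd.im_star, Int.cast_one, Int.cast_neg,
    Int.cast_zero]
  have h3 : (0 : AlgebraicClosure (ZMod ℓ)) + -1 * rootNegOne ℓ = - rootNegOne ℓ := by ring
  rw [h3, div_eq_iff (neg_ne_zero.mpr h0), zpow_ofNat, pow_two, hz]
  ring

end ResidueSymbol

theorem pow_eq_pow_four_pow_mul {M : Type*} [Monoid M] (a : M) {n : ℕ} (h : n % 4 = 1) :
    a ^ n = (a ^ 4) ^ (n / 4) * a := by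
  rw [← pow_mul, ← pow_succ]
  congr 1
  omega

/-! ### Quartic reciprocity from Gauss sums in characteristic ℓ. -/

namespace SplitPrime

variable (π : SplitPrime) (ℓ : ℕ) [Fact ℓ.Prime]

/-- The quartic residue character modulo a split prime, with values in characteristic `ℓ`. -/
noncomputable def redChar : MulChar (ZMod π.p) (AlgebraicClosure (ZMod ℓ)) :=
  π.mulChar.ringHomComp (redHom ℓ)

variable {ℓ}

theorem redChar_intCast {n : ℤ} (hn : (n : ZMod π.p) ≠ 0) :
    π.redChar ℓ n = rootNegOne ℓ ^ (π.chi n).val := by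
  rw [redChar, MulChar.ringHomComp_apply, mulChar_apply π hn, map_pow, redHom_I]
  rfl

theorem redChar_pow_four : π.redChar ℓ ^ 4 = 1 := by
  rw [redChar, MulChar.ringHomComp_pow, π.mulChar_pow_four, MulChar.ringHomComp_one]

theorem redChar_sq_ne_one (hℓ : ℓ ≠ 2) : π.redChar ℓ * π.redChar ℓ ≠ 1 := by
  obtain ⟨n, hn0, hn⟩ := π.exists_mulChar_sq_ne_one
  intro h
  have := congrArg (fun χ => χ n) h
  simp only [MulChar.mul_apply, MulChar.one_apply (isUnit_iff_ne_zero.mpr hn0), redChar,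
    MulChar.ringHomComp_apply] at this
  rw [← map_mul, ← pow_two, hn, map_neg, map_one] at this
  exact two_ne_zero_of_odd hℓ (by linear_combination -this)

theorem redChar_ne_one (hℓ : ℓ ≠ 2) : π.redChar ℓ ≠ 1 := by
  intro h
  exact π.redChar_sq_ne_one hℓ (by rw [h, one_mul])

theorem isQuadratic_redChar_sq : (π.redChar ℓ * π.redChar ℓ).IsQuadratic := by
  intro n
  by_cases hn : n = 0
  · left; rw [hn, MulChar.map_zero]
  right
  have h := congrArg (fun χ => χ n) (π.redChar_pow_four (ℓ := ℓ))
  simp only [MulChar.one_apply (isUnit_iff_ne_zero.mpr hn),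
    MulChar.pow_apply' _ (show (4 : ℕ) ≠ 0 by norm_num)] at h
  rw [MulChar.mul_apply]
  exact mul_self_eq_one_iff.mp (by linear_combination h)

theorem card_eq_redHom_mul :
    ((Fintype.card (ZMod π.p) : ℕ) : AlgebraicClosure (ZMod ℓ)) =
      redHom ℓ π.val * redHom ℓ (star π.val) := by
  have h : π.val.norm = (π.p : ℤ) := by rw [Zsqrtd.norm_def, π.norm_eq]; simp only [val]; ring
  rw [ZMod.card, redHom_mul_star, h, Int.cast_natCast]

/-- G(χ)² = G(χ²)J(χ,χ). Here χ² is quadratic and even, so G(χ²)² = p = ππ̄, while J² = π². -/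
theorem gaussSum_redChar_pow_four (hℓ : ℓ ≠ 2)
    {ψ : AddChar (ZMod π.p) (AlgebraicClosure (ZMod ℓ))} (hψ : ψ.IsPrimitive) :
    gaussSum (π.redChar ℓ) ψ ^ 4 = redHom ℓ π.val ^ 3 * redHom ℓ (star π.val) := by
  have h1 := jacobiSum_mul_nontrivial (π.redChar_sq_ne_one hℓ) ψ
  have h2 := gaussSum_sq (π.redChar_sq_ne_one hℓ) π.isQuadratic_redChar_sq hψ
  rw [MulChar.mul_apply, ← map_mul, neg_one_mul, neg_neg, map_one, one_mul,
    card_eq_redHom_mul] at h2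
  have hJ : jacobiSum (π.redChar ℓ) (π.redChar ℓ) ^ 2 = redHom ℓ π.val ^ 2 := by
    rw [redChar, jacobiSum_ringHomComp]
    rcases π.jacobiSum_eq with h | h
    · rw [h]
    · rw [h, map_neg, neg_sq]
  calc gaussSum (π.redChar ℓ) ψ ^ 4
      = (gaussSum (π.redChar ℓ) ψ * gaussSum (π.redChar ℓ) ψ) ^ 2 := by ring
    _ = gaussSum (π.redChar ℓ * π.redChar ℓ) ψ ^ 2 *
        jacobiSum (π.redChar ℓ) (π.redChar ℓ) ^ 2 := by rw [← h1, mul_pow]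
    _ = _ := by rw [h2, hJ]; ring

theorem coprimeNorm_val (h : ℓ ≠ π.p) : CoprimeNorm ℓ π.val := by
  have hn : π.val.norm = (π.p : ℤ) := by rw [Zsqrtd.norm_def, π.norm_eq]; simp only [val]; ring
  rw [CoprimeNorm, hn]
  intro hd
  exact h ((Nat.prime_dvd_prime_iff_eq Fact.out π.fact.out).mp (by exact_mod_cast hd))

theorem prime_ne_zero (h : ℓ ≠ π.p) : (ℓ : ZMod π.p) ≠ 0 := by
  rw [Ne, ZMod.natCast_eq_zero_iff]
  exact fun hd => h ((Nat.prime_dvd_prime_iff_eq π.fact.out Fact.out).mp hd).symm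

/-- Frobenius gives G(χ)^ℓ = χ^ℓ(ℓ)⁻¹G(χ^ℓ). If ℓ ≡ 1 (mod 4), then χ^ℓ = χ and G^(ℓ-1) = χ(ℓ)⁻¹; if
ℓ ≡ 3, then χ^ℓ = χ⁻¹ and G^(ℓ+1) = χ(-ℓ)ππ̄. In both cases the left side is a power of G⁴ = π³π̄,
and the action of Frobenius on π turns it into a power of π/π̄. -/
theorem redChar_signedNat (hℓ : ℓ ≠ 2) (hp : ℓ ≠ π.p) :
    π.redChar ℓ ((signedNat ℓ : ℤ) : ZMod π.p) = twist ℓ π.val := by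
  have ho := (Fact.out : ℓ.Prime).eq_two_or_odd.resolve_left hℓ
  have hcop := π.coprimeNorm_val hp
  have hl := hcop.left
  have hr := hcop.right
  have hu : IsUnit (ℓ : ZMod π.p) := isUnit_iff_ne_zero.mpr (π.prime_ne_zero hp)
  have hp0 : ((π.p : ℕ) : AlgebraicClosure (ZMod ℓ)) ≠ 0 := by
    have := card_eq_redHom_mul π (ℓ := ℓ)
    rw [ZMod.card] at this
    rw [this]
    exact mul_ne_zero hl hr
  have : NeZero ((π.p : ℕ) : AlgebraicClosure (ZMod ℓ)) := ⟨hp0⟩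
  obtain ⟨ξ, hξ⟩ := HasEnoughRootsOfUnity.exists_primitiveRoot (AlgebraicClosure (ZMod ℓ)) π.p
  have hψ := AddChar.zmodChar_primitive_of_primitive_root π.p hξ
  set ψ := AddChar.zmodChar π.p ((IsPrimitiveRoot.iff_def ξ π.p).mp hξ).left
  set χ := π.redChar ℓ with hχ
  have hg := π.gaussSum_redChar_pow_four hℓ hψ
  rw [← hχ] at hg
  have hg0 : gaussSum χ ψ ≠ 0 := by
    intro h
    rw [h, zero_pow (by norm_num)] at hg
    exact mul_ne_zero (pow_ne_zero 3 hl) hr hg.symm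
  have hfrob : gaussSum χ ψ ^ ℓ = (χ ^ ℓ)⁻¹ ℓ * gaussSum (χ ^ ℓ) ψ := by
    rw [gaussSum_frob, AddChar.pow_mulShift, ← hu.unit_spec, gaussSum_mulShift_eq]
  rw [twist]
  rcases signedNat_cases ho with ⟨h4, e⟩ | ⟨h4, e⟩
  · have hk : ℓ = 4 * (ℓ / 4) + 1 := by omega
    set k := ℓ / 4
    have hχℓ : χ ^ ℓ = χ := by
      rw [pow_eq_pow_four_pow_mul _ h4, π.redChar_pow_four, one_pow, one_mul]
    rw [hχℓ] at hfrob
    have h1 : (gaussSum χ ψ ^ 4) ^ k = χ⁻¹ ℓ := by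
      rw [pow_eq_pow_four_pow_mul _ h4] at hfrob
      exact mul_right_cancel₀ hg0 hfrob
    have h2 : χ⁻¹ ℓ * χ ℓ = 1 := by
      rw [← MulChar.mul_apply, inv_mul_cancel, MulChar.one_apply hu]
    have h3 : (redHom ℓ π.val ^ 4) ^ k = 1 := by
      have := redHom_pow_of_one h4 π.val
      rw [pow_eq_pow_four_pow_mul _ h4] at this
      exact mul_right_cancel₀ hl (by rw [this, one_mul])
    rw [e, Int.cast_natCast, show ((ℓ : ℤ) - 1) / 4 = (k : ℤ) by omega, zpow_natCast]
    rw [← h1, hg] at h2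
    have h5 : (redHom ℓ π.val ^ 3 * redHom ℓ (star π.val)) ^ k *
        (redHom ℓ π.val / redHom ℓ (star π.val)) ^ k = 1 := by
      rw [← mul_pow, ← h3]
      congr 1
      field_simp
    exact mul_left_cancel₀ (left_ne_zero_of_mul_eq_one h2) (h2.trans h5.symm)
  · have hk : ℓ + 1 = 4 * ((ℓ + 1) / 4) := by omega
    set k := (ℓ + 1) / 4
    have hχℓ : χ ^ ℓ = χ⁻¹ := by
      refine eq_inv_of_mul_eq_one_left ?_
      rw [← pow_succ, hk, pow_mul, π.redChar_pow_four, one_pow]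
    rw [hχℓ, inv_inv] at hfrob
    have h6 := gaussSum_mul_gaussSum_eq_card (π.redChar_ne_one hℓ) hψ
    rw [← hχ, card_eq_redHom_mul] at h6
    have h7 := mul_gaussSum_inv_eq_gaussSum χ⁻¹ ψ
    have h8 : χ⁻¹ (-1) = χ (-1) := by rw [MulChar.inv_apply', inv_neg_one]
    have h9 : (gaussSum χ ψ ^ 4) ^ k =
        χ (-ℓ) * (redHom ℓ π.val * redHom ℓ (star π.val)) := by
      rw [← pow_mul, ← hk, pow_succ, hfrob, ← h7, h8, ← h6, neg_eq_neg_one_mul (ℓ : ZMod π.p), map_mul]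
      ring
    have h3 : (redHom ℓ π.val ^ 4) ^ k = redHom ℓ π.val * redHom ℓ (star π.val) := by
      rw [← pow_mul, ← hk, pow_succ, redHom_pow_of_three h4, mul_comm]
    rw [e, Int.cast_neg, Int.cast_natCast, show (-(ℓ : ℤ) - 1) / 4 = -(k : ℤ) by omega, zpow_neg,
      zpow_natCast, ← inv_pow, inv_div]
    rw [hg] at h9
    refine mul_right_cancel₀ (mul_ne_zero hl hr) (h9.symm.trans ?_)
    rw [← h3, ← mul_pow]
    congr 1
    field_simp

/-- **Rational quartic reciprocity** for primes. -/
theorem chi_signedNat (hℓ : ℓ ≠ 2) (hp : ℓ ≠ π.p) :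
    π.chi (signedNat ℓ) = quarticSymbol ℓ π.val := by
  have hn : ((signedNat ℓ : ℤ) : ZMod π.p) ≠ 0 := by
    have := π.prime_ne_zero hp
    rcases signedNat_cases ((Fact.out : ℓ.Prime).eq_two_or_odd.resolve_left hℓ) with
      ⟨-, e⟩ | ⟨-, e⟩ <;> rw [e] <;> simpa using this
  refine (quarticLog_eq (rootNegOne_mul_self ℓ) (two_ne_zero_of_odd hℓ) ?_).symm
  rw [← π.redChar_signedNat hℓ hp, π.redChar_intCast hn]

end SplitPrime

/-! ### Composite moduli: odd integers below, products of split primes above. -/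

section Composite

open Classical in
/-- The exponent of the quartic symbol modulo an odd rational prime, extended by `0`. -/
noncomputable def primeSymbol (ℓ : ℕ) (α : GaussianInt) : ZMod 4 :=
  if h : ℓ.Prime then
    have : Fact ℓ.Prime := ⟨h⟩
    quarticSymbol ℓ α
  else 0

theorem primeSymbol_eq (ℓ : ℕ) [h : Fact ℓ.Prime] (α : GaussianInt) :
    primeSymbol ℓ α = quarticSymbol ℓ α :=
  dif_pos h.out

/-- The exponent of the quartic Jacobi symbol of a Gaussian integer modulo an odd number. -/
noncomputable def quarticJacobi (n : ℕ) (α : GaussianInt) : ZMod 4 :=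
  n.factorization.sum fun ℓ k => (k : ZMod 4) * primeSymbol ℓ α

theorem quarticJacobi_mul_left {m n : ℕ} (hm : m ≠ 0) (hn : n ≠ 0) (α : GaussianInt) :
    quarticJacobi (m * n) α = quarticJacobi m α + quarticJacobi n α := by
  rw [quarticJacobi, Nat.factorization_mul hm hn, Finsupp.sum_add_index']
  · rfl
  · simp
  · intro ℓ j k
    push_cast
    ring

theorem quarticJacobi_one (α : GaussianInt) : quarticJacobi 1 α = 0 := by
  simp [quarticJacobi]

theorem quarticJacobi_prime {ℓ : ℕ} (h : ℓ.Prime) (α : GaussianInt) :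
    quarticJacobi ℓ α = primeSymbol ℓ α := by
  rw [quarticJacobi, h.factorization, Finsupp.sum_single_index (by simp)]
  simp

theorem quarticJacobi_congr_symbol {n : ℕ} {α β : GaussianInt}
    (h : ∀ ℓ, ℓ.Prime → ℓ ∣ n → primeSymbol ℓ α = primeSymbol ℓ β) :
    quarticJacobi n α = quarticJacobi n β := by
  unfold quarticJacobi Finsupp.sum
  refine Finset.sum_congr rfl fun ℓ hℓ => ?_
  rw [Nat.support_factorization] at hℓ
  simp only [h ℓ (Nat.prime_of_mem_primeFactors hℓ) (Nat.dvd_of_mem_primeFactors hℓ)]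

theorem ne_two_of_dvd_odd {ℓ n : ℕ} (hn : n % 2 = 1) (h : ℓ ∣ n) : ℓ ≠ 2 := by
  rintro rfl
  omega

theorem coprimeNorm_of_isCoprime {ℓ n : ℕ} {α : GaussianInt} (h : IsCoprime (n : ℤ) α.norm)
    (hℓ : ℓ.Prime) (hd : ℓ ∣ n) : CoprimeNorm ℓ α := by
  intro h'
  have := h.isUnit_of_dvd' (Int.natCast_dvd_natCast.mpr hd) h'
  rw [Int.isUnit_iff] at this
  have := hℓ.two_le
  omega

theorem quarticJacobi_mul {n : ℕ} (hn : n % 2 = 1) {α β : GaussianInt}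
    (hα : IsCoprime (n : ℤ) α.norm) (hβ : IsCoprime (n : ℤ) β.norm) :
    quarticJacobi n (α * β) = quarticJacobi n α + quarticJacobi n β := by
  rw [quarticJacobi, quarticJacobi, quarticJacobi, ← Finsupp.sum_add]
  refine Finset.sum_congr rfl fun ℓ hℓ => ?_
  rw [Nat.support_factorization] at hℓ
  have hp := Nat.prime_of_mem_primeFactors hℓ
  have hd := Nat.dvd_of_mem_primeFactors hℓ
  have : Fact ℓ.Prime := ⟨hp⟩
  simp only [primeSymbol_eq]
  rw [quarticSymbol_mul (ne_two_of_dvd_odd hn hd) (coprimeNorm_of_isCoprime hα hp hd)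
    (coprimeNorm_of_isCoprime hβ hp hd), mul_add]

theorem quarticJacobi_congr {n : ℕ} {α β : GaussianInt} (hr : (n : ℤ) ∣ α.re - β.re)
    (hi : (n : ℤ) ∣ α.im - β.im) : quarticJacobi n α = quarticJacobi n β := by
  refine quarticJacobi_congr_symbol fun ℓ hℓ hd => ?_
  have : Fact ℓ.Prime := ⟨hℓ⟩
  rw [primeSymbol_eq, primeSymbol_eq]
  exact quarticSymbol_congr ((Int.natCast_dvd_natCast.mpr hd).trans hr)
    ((Int.natCast_dvd_natCast.mpr hd).trans hi)

theorem quarticJacobi_intCast {n : ℕ} (hn : n % 2 = 1) {m : ℤ} (h : IsCoprime (n : ℤ) m) :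
    quarticJacobi n m = 0 := by
  unfold quarticJacobi Finsupp.sum
  refine Finset.sum_eq_zero fun ℓ hℓ => ?_
  rw [Nat.support_factorization] at hℓ
  have hp := Nat.prime_of_mem_primeFactors hℓ
  have hd := Nat.dvd_of_mem_primeFactors hℓ
  have : Fact ℓ.Prime := ⟨hp⟩
  simp only [primeSymbol_eq]
  rw [quarticSymbol_intCast (ne_two_of_dvd_odd hn hd), mul_zero]
  intro h'
  have := h.isUnit_of_dvd' (Int.natCast_dvd_natCast.mpr hd) h'
  rw [Int.isUnit_iff] at this
  have := hp.two_le
  omega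

/-- (4u+1)(4v+1) = 4(4uv+u+v) + 1. This additivity carries the supplementary law for 1+i from primes
to composites. -/
theorem cast_sub_one_div_four_mul {m n : ℤ} (hm : m % 4 = 1) (hn : n % 4 = 1) :
    (((m * n - 1) / 4 : ℤ) : ZMod 4) = ((m - 1) / 4 : ℤ) + ((n - 1) / 4 : ℤ) := by
  obtain ⟨u, rfl⟩ : ∃ u, m = 4 * u + 1 := ⟨m / 4, by omega⟩
  obtain ⟨v, rfl⟩ : ∃ v, n = 4 * v + 1 := ⟨n / 4, by omega⟩
  have h1 : ((4 * u + 1) * (4 * v + 1) - 1) / 4 = 4 * (u * v) + u + v := by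
    rw [show (4 * u + 1) * (4 * v + 1) - 1 = 4 * (4 * (u * v) + u + v) by ring]
    omega
  rw [h1, show (4 * u + 1 - 1) / 4 = u by omega, show (4 * v + 1 - 1) / 4 = v by omega]
  push_cast
  rw [show (4 : ZMod 4) = 0 from rfl]
  ring

theorem quarticJacobi_one_add_I {n : ℕ} (hn : n % 2 = 1) :
    quarticJacobi n ⟨1, 1⟩ = ((signedNat n - 1) / 4 : ℤ) := by
  induction n using Nat.recOnMul with
  | zero => simp at hn
  | one => rw [quarticJacobi_one]; simp [signedNat]
  | prime ℓ h =>
    have : Fact ℓ.Prime := ⟨h⟩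
    rw [quarticJacobi_prime h, primeSymbol_eq, quarticSymbol_one_add_I (by omega)]
  | mul a b iha ihb =>
    have ha : a % 2 = 1 := Nat.odd_iff.mp (Nat.odd_mul.mp (Nat.odd_iff.mpr hn)).1
    have hb : b % 2 = 1 := Nat.odd_iff.mp (Nat.odd_mul.mp (Nat.odd_iff.mpr hn)).2
    rw [quarticJacobi_mul_left (by omega) (by omega), iha ha, ihb hb, signedNat_mul,
      cast_sub_one_div_four_mul (signedNat_mod_four ha) (signedNat_mod_four hb)]

namespace SplitPrime

theorem intCast_ne_zero_of_isCoprime {π : SplitPrime} {n m : ℤ} (h : IsCoprime n m)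
    (hd : (π.p : ℤ) ∣ m) : (n : ZMod π.p) ≠ 0 := by
  rw [Ne, ZMod.intCast_zmod_eq_zero_iff_dvd]
  intro h'
  have := h.isUnit_of_dvd' h' hd
  rw [Int.isUnit_iff] at this
  have := π.fact.out.two_le
  omega

theorem chi_signedNat_eq_quarticJacobi (π : SplitPrime) {n : ℕ} (hn : n % 2 = 1)
    (hp : ¬ π.p ∣ n) : π.chi (signedNat n) = quarticJacobi n π.val := by
  induction n using Nat.recOnMul with
  | zero => simp at hn
  | one => rw [quarticJacobi_one]; simp [signedNat, chi_one]
  | prime ℓ h =>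
    have : Fact ℓ.Prime := ⟨h⟩
    rw [quarticJacobi_prime h, primeSymbol_eq, chi_signedNat π (by omega)]
    rintro rfl
    exact hp dvd_rfl
  | mul a b iha ihb =>
    have ha : a % 2 = 1 := Nat.odd_iff.mp (Nat.odd_mul.mp (Nat.odd_iff.mpr hn)).1
    have hb : b % 2 = 1 := Nat.odd_iff.mp (Nat.odd_mul.mp (Nat.odd_iff.mpr hn)).2
    have hpa : ¬ π.p ∣ a := fun h => hp (h.mul_right b)
    have hpb : ¬ π.p ∣ b := fun h => hp (h.mul_left a)
    have key : ∀ m : ℕ, m % 2 = 1 → ¬ π.p ∣ m → ((signedNat m : ℤ) : ZMod π.p) ≠ 0 := by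
      intro m hm hpm
      rw [← ZMod.natCast_eq_zero_iff] at hpm
      rcases signedNat_cases hm with ⟨-, e⟩ | ⟨-, e⟩ <;> rw [e] <;> simpa using hpm
    rw [quarticJacobi_mul_left (by omega) (by omega), ← iha ha hpa, ← ihb hb hpb, signedNat_mul,
      chi_mul (key a ha hpa) (key b hb hpb)]

/-- The product of a list of split primes. -/
def listProd (M : List SplitPrime) : GaussianInt := (M.map val).prod

/-- The exponent of the quartic residue symbol modulo a product of split primes. -/
noncomputable def listChi (M : List SplitPrime) (n : ℤ) : ZMod 4 := (M.map fun π => π.chi n).sum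

theorem norm_val (π : SplitPrime) : π.val.norm = π.p := by
  rw [Zsqrtd.norm_def, π.norm_eq]; simp only [val]; ring

theorem dvd_norm_listProd {M : List SplitPrime} {π : SplitPrime} (h : π ∈ M) :
    (π.p : ℤ) ∣ (listProd M).norm := by
  induction M with
  | nil => simp at h
  | cons σ M ih =>
    rw [listProd, List.map_cons, List.prod_cons, Zsqrtd.norm_mul]
    rcases List.mem_cons.mp h with rfl | h
    · rw [norm_val]; exact dvd_mul_right _ _
    · exact (ih h).mul_left _

theorem listChi_mul {M : List SplitPrime} {m n : ℤ} (hm : IsCoprime m (listProd M).norm)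
    (hn : IsCoprime n (listProd M).norm) :
    listChi M (m * n) = listChi M m + listChi M n := by
  rw [listChi, listChi, listChi, ← List.sum_map_add]
  congr 1
  refine List.map_congr_left fun π h => ?_
  exact chi_mul (intCast_ne_zero_of_isCoprime hm (dvd_norm_listProd h))
    (intCast_ne_zero_of_isCoprime hn (dvd_norm_listProd h))

theorem listChi_congr {M : List SplitPrime} {m n : ℤ} (h : (listProd M).norm ∣ m - n) :
    listChi M m = listChi M n := by
  rw [listChi, listChi]
  congr 1
  refine List.map_congr_left fun π hπ => ?_
  refine chi_congr ?_
  rw [← sub_eq_zero, ← Int.cast_sub, ZMod.intCast_zmod_eq_zero_iff_dvd]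
  exact (dvd_norm_listProd hπ).trans h

theorem listChi_neg_one (M : List SplitPrime) :
    (listProd M).norm % 4 = 1 ∧
      listChi M (-1) = 2 * (((listProd M).norm - 1) / 4 : ℤ) := by
  induction M with
  | nil => simp [listChi, listProd]
  | cons π M ih =>
    have h4 := π.p_mod_four
    obtain ⟨h1, h2⟩ := ih
    have e : (listProd (π :: M)).norm = π.p * (listProd M).norm := by
      rw [listProd, List.map_cons, List.prod_cons, Zsqrtd.norm_mul, norm_val]; rfl
    have e' : listChi (π :: M) (-1) = π.chi (-1) + listChi M (-1) := by
      rw [listChi, List.map_cons, List.sum_cons]; rfl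
    rw [e, e', h2, cast_sub_one_div_four_mul (by omega) h1, chi_neg_one,
      show ((π.p : ℤ) - 1) / 4 = ((π.p - 1) / 4 : ℕ) by omega]
    refine ⟨by rw [Int.mul_emod, h1, show (π.p : ℤ) % 4 = 1 by omega]; rfl, ?_⟩
    rw [Int.cast_natCast]
    ring

/-- For p ≡ 1 (mod 4), 2^((p-1)/2) and (-1)^((p-1)/4) are both 1 when p ≡ 1 (mod 8) and both -1 when
p ≡ 5. -/
theorem two_mul_chi_two (π : SplitPrime) : 2 * π.chi 2 = π.chi (-1) := by
  have h4 := π.p_mod_four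
  have hp := π.fact.out.two_le
  have h2 : ((2 : ℤ) : ZMod π.p) ≠ 0 := by exact_mod_cast π.two_ne_zero
  have h1 : ((-1 : ℤ) : ZMod π.p) ≠ 0 := by simp
  have e : π.chi 2 + π.chi 2 = π.chi (-1) := by
    refine pow_val_injective π.imag_mul_self π.two_ne_zero ?_
    simp only
    rw [pow_val_add π.imag_mul_self, imag_pow_chi h2, imag_pow_chi h1, ← pow_two, ← pow_mul,
      show (π.p - 1) / 4 * 2 = Fintype.card (ZMod π.p) / 2 by rw [ZMod.card]; omega]
    push_cast
    rw [FiniteField.two_pow_card (by rw [ZMod.ringChar_zmod_n]; omega), ZMod.card,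
      ZMod.χ₈_nat_eq_if_mod_eight]
    rcases (by omega : π.p % 8 = 1 ∨ π.p % 8 = 5) with h | h
    · rw [Even.neg_one_pow (Nat.even_iff.mpr (by omega)), if_neg (by omega), if_pos (Or.inl h)]
      simp
    · rw [Odd.neg_one_pow (Nat.odd_iff.mpr (by omega)), if_neg (by omega), if_neg (by omega)]
      simp
  rw [← e, two_mul]

theorem two_mul_listChi_two (M : List SplitPrime) : 2 * listChi M 2 = listChi M (-1) := by
  rw [listChi, listChi, ← List.sum_map_mul_left]
  congr 1
  exact List.map_congr_left fun π _ => π.two_mul_chi_two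

/-- **Rational quartic reciprocity** for products of split primes. -/
theorem listChi_eq_quarticJacobi {M : List SplitPrime} {n : ℤ} (hn : n % 4 = 1)
    (h : IsCoprime n (listProd M).norm) :
    listChi M n = quarticJacobi n.natAbs (listProd M) := by
  induction M with
  | nil =>
    have : listProd [] = ((1 : ℤ) : GaussianInt) := by simp [listProd]
    rw [this, quarticJacobi_intCast (by omega) isCoprime_one_right]
    rfl
  | cons π M ih =>
    have e : listProd (π :: M) = π.val * listProd M := by
      rw [listProd, List.map_cons, List.prod_cons]; rfl
    have e' : listChi (π :: M) n = π.chi n + listChi M n := by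
      rw [listChi, List.map_cons, List.sum_cons]; rfl
    rw [e, Zsqrtd.norm_mul] at h
    obtain ⟨h1, h2⟩ := IsCoprime.mul_right_iff.mp h
    have key : ∀ m : ℤ, IsCoprime n m → IsCoprime (n.natAbs : ℤ) m := by
      intro m hm
      rw [Int.natCast_natAbs]
      exact hm.abs_left
    have hp : ¬ π.p ∣ n.natAbs := by
      have := intCast_ne_zero_of_isCoprime (π := π) h1 (by rw [norm_val])
      rwa [Ne, ZMod.intCast_zmod_eq_zero_iff_dvd, Int.natCast_dvd] at this
    have := π.chi_signedNat_eq_quarticJacobi (n := n.natAbs) (by omega) hp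
    rw [signedNat_natAbs hn] at this
    rw [e, e', quarticJacobi_mul (by omega) (key _ h1) (key _ h2), this, ih h2]

/-- A primitive element of odd norm has only split prime factors, since -1 is a square modulo its
norm. Keeping all imaginary parts even leaves only a sign as unit ambiguity. The induction divides
off one prime at a time. -/
theorem exists_list_norm (N : ℕ) : ∀ a b : ℤ, a ^ 2 + b ^ 2 = N → IsCoprime a b → N % 2 = 1 →
    2 ∣ b → ∃ M : List SplitPrime, (⟨a, b⟩ : GaussianInt) = listProd M ∨
      (⟨a, b⟩ : GaussianInt) = -listProd M := by
  induction N using Nat.strong_induction_on with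
  | _ N ih =>
  intro a b hN hab hodd hb
  obtain ⟨b', hb'⟩ := hb
  rcases eq_or_ne N 1 with rfl | hN1
  · have hb0 : b = 0 := by
      by_contra h0
      have h1 : b' ≠ 0 := by rintro rfl; simp at hb'; exact h0 hb'
      have : 1 ≤ b' ^ 2 := by have := sq_nonneg b'; have : b' ^ 2 ≠ 0 := by positivity
                              omega
      rw [hb'] at hN
      push_cast at hN
      nlinarith [sq_nonneg a]
    subst hb0
    refine ⟨[], ?_⟩
    have ha : a * a = 1 := by push_cast at hN; linarith
    rcases mul_self_eq_one_iff.mp ha with rfl | rfl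
    · left; rfl
    · right; rfl
  · obtain ⟨p, hp, hpN⟩ := Nat.exists_prime_and_dvd hN1
    have : Fact p.Prime := ⟨hp⟩
    have hN0 : N ≠ 0 := by omega
    have hp3 : p % 4 ≠ 3 := by
      have hs := ZMod.isSquare_neg_one_of_eq_sq_add_sq_of_isCoprime hN.symm hab
      exact Nat.mod_four_ne_three_of_mem_primeFactors_of_isSquare_neg_one
        (Nat.mem_primeFactors.mpr ⟨hp, hpN, hN0⟩) hs
    have hp2 : p ≠ 2 := ne_two_of_dvd_odd hodd hpN
    have hpo := hp.eq_two_or_odd.resolve_left hp2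
    obtain ⟨s, t, hst, hte⟩ : ∃ s t : ℤ, (p : ℤ) = s ^ 2 + t ^ 2 ∧ 2 ∣ t := by
      obtain ⟨s, t, hst⟩ := Nat.Prime.sq_add_sq hp3
      have hst' : (p : ℤ) = (s : ℤ) ^ 2 + (t : ℤ) ^ 2 := by exact_mod_cast hst.symm
      rcases Nat.even_or_odd t with ht | ht
      · exact ⟨s, t, hst', by exact_mod_cast ht.two_dvd⟩
      · rcases Nat.even_or_odd s with hs | hs
        · exact ⟨t, s, by rw [hst']; ring, by exact_mod_cast hs.two_dvd⟩
        · exfalso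
          have : Even p := by rw [← hst]; exact (hs.pow).add_odd (ht.pow)
          rw [Nat.even_iff] at this
          omega
    obtain ⟨m, hm⟩ := hpN
    have hpz : Prime (p : ℤ) := Nat.prime_iff_prime_int.mp hp
    have hp0 : (p : ℤ) ≠ 0 := by exact_mod_cast hp.ne_zero
    have hN' : a ^ 2 + b ^ 2 = p * m := by rw [hN, hm]; push_cast; rfl
    -- p divides (bs-at)(bs+at), so after conjugating s + ti if necessary p divides both parts of
    -- (a+bi)(s-ti).
    obtain ⟨t, hst, hte, hd⟩ : ∃ t : ℤ, (p : ℤ) = s ^ 2 + t ^ 2 ∧ 2 ∣ t ∧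
        (p : ℤ) ∣ b * s - a * t := by
      have : (p : ℤ) ∣ (b * s - a * t) * (b * s + a * t) :=
        ⟨b ^ 2 - t ^ 2 * m, by linear_combination (-t ^ 2) * hN' - b ^ 2 * hst⟩
      rcases hpz.dvd_or_dvd this with h | h
      · exact ⟨t, hst, hte, h⟩
      · exact ⟨-t, by rw [hst]; ring, by simpa using hte, by simpa using h⟩
    have hd' : (p : ℤ) ∣ a * s + b * t := by
      refine hpz.dvd_of_dvd_pow (n := 2) ?_
      obtain ⟨k, hk⟩ := hd
      exact ⟨(p : ℤ) * m - p * k ^ 2, by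
        linear_combination (s ^ 2 + t ^ 2) * hN' - (p * m : ℤ) * hst - (b * s - a * t + p * k) * hk⟩
    obtain ⟨v, hv⟩ := hd
    obtain ⟨u, hu⟩ := hd'
    have ha : a = s * u - t * v := mul_left_cancel₀ hp0 (by
      linear_combination a * hst - t * hv + s * hu)
    have hb : b = s * v + t * u := mul_left_cancel₀ hp0 (by
      linear_combination b * hst + s * hv + t * hu)
    have huv : u ^ 2 + v ^ 2 = m := mul_left_cancel₀ hp0 (by
      rw [← hN', ha, hb, hst]; ring)
    have hcop : IsCoprime u v := by
      obtain ⟨x, y, hxy⟩ := hab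
      exact ⟨x * s + y * t, y * s - x * t, by rw [← hxy, ha, hb]; ring⟩
    have hso : s % 2 = 1 := by
      obtain ⟨t', rfl⟩ := hte
      by_contra h
      obtain ⟨s', rfl⟩ : ∃ s', s = 2 * s' := ⟨s / 2, by omega⟩
      have : (p : ℤ) = 2 * (2 * s' ^ 2 + 2 * t' ^ 2) := by rw [hst]; ring
      omega
    have hv2 : 2 ∣ v := by
      have h1 : (2 : ℤ) ∣ s * v := by
        have : s * v = b - t * u := by rw [hb]; ring
        rw [this]
        exact dvd_sub ⟨b', hb'⟩ (hte.mul_right u)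
      rcases Int.prime_two.dvd_or_dvd h1 with h | h
      · omega
      · exact h
    have hmo : m % 2 = 1 := Nat.odd_iff.mp (Nat.odd_mul.mp (Nat.odd_iff.mpr (hm ▸ hodd))).2
    have hlt : m < N := by
      rw [hm]
      exact lt_mul_of_one_lt_left (by omega) hp.one_lt
    obtain ⟨M, hM⟩ := ih m hlt u v huv hcop hmo hv2
    refine ⟨⟨p, ⟨hp⟩, s, t, hst, hte⟩ :: M, ?_⟩
    have e : (⟨a, b⟩ : GaussianInt) = ⟨s, t⟩ * ⟨u, v⟩ := by
      apply Zsqrtd.ext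
      · simp only [Zsqrtd.re_mul]; rw [ha]; ring
      · simp only [Zsqrtd.im_mul]; rw [hb]
    rw [e, listProd, List.map_cons, List.prod_cons]
    rcases hM with h | h
    · left; rw [h]; rfl
    · right; rw [h, mul_neg]; rfl

end SplitPrime

end Composite

/-! ### The circle parametrisation and symbols along A·g = C². -/

section CircleMethod

theorem quarticSymbol_neg (ℓ : ℕ) [Fact ℓ.Prime] (α : GaussianInt) :
    quarticSymbol ℓ (-α) = quarticSymbol ℓ α := by
  rw [quarticSymbol, quarticSymbol, twist, twist, star_neg, map_neg, map_neg, neg_div_neg_eq]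

theorem quarticJacobi_neg (n : ℕ) (α : GaussianInt) :
    quarticJacobi n (-α) = quarticJacobi n α :=
  quarticJacobi_congr_symbol fun ℓ hℓ _ => by
    have : Fact ℓ.Prime := ⟨hℓ⟩
    rw [primeSymbol_eq, primeSymbol_eq, quarticSymbol_neg]

theorem quarticSymbol_I_eq {ℓ : ℕ} [Fact ℓ.Prime] (hℓ : ℓ ≠ 2) :
    quarticSymbol ℓ ⟨0, 1⟩ = 2 * quarticSymbol ℓ ⟨1, 1⟩ := by
  rw [quarticSymbol_I hℓ, quarticSymbol_one_add_I hℓ]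

theorem norm_I : (⟨0, 1⟩ : GaussianInt).norm = 1 := by decide

theorem norm_one_add_I : (⟨1, 1⟩ : GaussianInt).norm = 2 := by decide

theorem coprimeNorm_I {ℓ : ℕ} [h : Fact ℓ.Prime] : CoprimeNorm ℓ ⟨0, 1⟩ := by
  rw [CoprimeNorm, norm_I]
  have := h.out.two_le
  intro h
  have := Int.le_of_dvd (by norm_num) h
  omega

/-- With w = c + (x+d)z and π = c + dz, the circle equation gives wxz = -πw̄. Squaring, and using x²
= ππ̄, yields (w/w̄)² = -π/π̄; here it is stated without denominators, with -1 = z/(-z). -/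
theorem circle_identity {K : Type*} [Field K] {c d x z : K} (hx : x ≠ 0) (hz : z * z = -1)
    (hn : c ^ 2 + d ^ 2 = x ^ 2) :
    (c + (x + d) * z) * (c + (x + d) * z) * (-z * (c - d * z)) =
      (c + d * z) * z * ((c - (x + d) * z) * (c - (x + d) * z)) := by
  have h : (c + (x + d) * z) * x * z = -((c + d * z) * (c - (x + d) * z)) := by
    linear_combination (x ^ 2 - d ^ 2) * hz + hn
  refine mul_left_cancel₀ (pow_ne_zero 2 hx) ?_
  linear_combination (-z * (c - d * z) * x ^ 2 * (c + (x + d) * z) ^ 2) * hz +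
    z * (c - d * z) * ((c + (x + d) * z) * x * z - (c + d * z) * (c - (x + d) * z)) * h +
    z * (c + d * z) * (c - (x + d) * z) ^ 2 * (hn - d ^ 2 * hz)

/-- If the norm of `c + d i` is congruent to `x²`, the symbol of `c + (x + d) i` is a square root of
the symbol of `i (c + d i)`. -/
theorem two_mul_quarticSymbol {ℓ : ℕ} [Fact ℓ.Prime] (hℓ : ℓ ≠ 2) {c d x : ℤ}
    (hn : (ℓ : ℤ) ∣ c ^ 2 + d ^ 2 - x ^ 2) (hx : ¬ (ℓ : ℤ) ∣ x)
    (hw : CoprimeNorm ℓ ⟨c, x + d⟩) :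
    2 * quarticSymbol ℓ ⟨c, x + d⟩ = quarticSymbol ℓ ⟨c, d⟩ + quarticSymbol ℓ ⟨0, 1⟩ := by
  have hx0 : (x : AlgebraicClosure (ZMod ℓ)) ≠ 0 := intCast_ne_zero_iff.mpr hx
  have hz := rootNegOne_mul_self ℓ
  have hz0 := rootNegOne_ne_zero (ℓ := ℓ)
  have hn' : ((c : AlgebraicClosure (ZMod ℓ)) ^ 2 + d ^ 2) = x ^ 2 := by
    rw [← sub_eq_zero]
    have := (CharP.intCast_eq_zero_iff (AlgebraicClosure (ZMod ℓ)) ℓ _).mpr hn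
    exact_mod_cast this
  have hπ : CoprimeNorm ℓ ⟨c, d⟩ := by
    rw [CoprimeNorm, ← intCast_ne_zero_iff, Zsqrtd.norm_def]
    push_cast
    rw [show (c : AlgebraicClosure (ZMod ℓ)) * c - -1 * d * d = x ^ 2 by rw [← hn']; ring]
    exact pow_ne_zero 2 hx0
  have key : twist ℓ (⟨c, x + d⟩ * ⟨c, x + d⟩) = twist ℓ (⟨c, d⟩ * ⟨0, 1⟩) := by
    have h1 := hw.right
    have h2 := hπ.right
    rw [twist, twist, star_mul, star_mul, map_mul, map_mul, map_mul, map_mul]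
    congr 1
    rw [div_eq_div_iff (mul_ne_zero h1 h1) (mul_ne_zero coprimeNorm_I.right h2)]
    simp only [redHom_apply, Zsqrtd.re_star, Zsqrtd.im_star, Int.cast_add, Int.cast_neg,
      Int.cast_zero, Int.cast_one]
    linear_combination circle_identity hx0 hz hn'
  rw [two_mul, ← quarticSymbol_mul hℓ hw hw, ← quarticSymbol_mul hℓ hπ coprimeNorm_I, quarticSymbol,
    key, quarticSymbol]

theorem quarticJacobi_eq_sum {n : ℕ} {S : Finset ℕ} (h : n.primeFactors ⊆ S) (α : GaussianInt) :
    quarticJacobi n α = ∑ ℓ ∈ S, (n.factorization ℓ : ZMod 4) * primeSymbol ℓ α :=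
  Finsupp.sum_of_support_subset _ (by rwa [Nat.support_factorization]) _ (by simp)

/-- Prime by prime, v(A) + v(g) = 2v(C). Away from g this halves β to α; at primes of g the total
weight of γ is 4v(C), which is 0 in ℤ/4. -/
theorem quarticJacobi_of_mul_eq_sq {A g C : ℕ} {α β γ : GaussianInt} (hC : C ≠ 0)
    (hA : A * g = C ^ 2)
    (h : ∀ ℓ, ℓ.Prime → ℓ ∣ C → (¬ ℓ ∣ g ∧ 2 * primeSymbol ℓ α = primeSymbol ℓ β) ∨
      (primeSymbol ℓ β = 2 * primeSymbol ℓ γ ∧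
        (¬ ℓ ∣ A ∨ primeSymbol ℓ α = -primeSymbol ℓ γ))) :
    quarticJacobi A α = quarticJacobi C β + quarticJacobi g γ := by
  have hC2 : C ^ 2 ≠ 0 := pow_ne_zero 2 hC
  have hA0 : A ≠ 0 := by rintro rfl; exact hC2 (by rw [← hA]; simp)
  have hg0 : g ≠ 0 := by rintro rfl; exact hC2 (by rw [← hA]; simp)
  have hs : ∀ n, n ∣ C ^ 2 → n.primeFactors ⊆ C.primeFactors := by
    intro n hn
    have := Nat.primeFactors_mono hn hC2
    rwa [Nat.primeFactors_pow _ (by norm_num)] at this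
  rw [quarticJacobi_eq_sum (hs A ⟨g, hA.symm⟩),
    quarticJacobi_eq_sum (hs g ⟨A, by rw [← hA, mul_comm]⟩),
    quarticJacobi_eq_sum (subset_refl C.primeFactors), ← Finset.sum_add_distrib]
  refine Finset.sum_congr rfl fun ℓ hℓ => ?_
  have hp := Nat.prime_of_mem_primeFactors hℓ
  have hf : A.factorization ℓ + g.factorization ℓ = 2 * C.factorization ℓ := by
    rw [← Finsupp.add_apply, ← Nat.factorization_mul hA0 hg0, hA, Nat.factorization_pow]
    simp
  have hf' : (A.factorization ℓ : ZMod 4) + g.factorization ℓ = 2 * C.factorization ℓ := by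
    exact_mod_cast congrArg (Nat.cast (R := ZMod 4)) hf
  have h4 : (4 : ZMod 4) = 0 := rfl
  rcases h ℓ hp (Nat.dvd_of_mem_primeFactors hℓ) with ⟨h1, h2⟩ | ⟨h1, h2 | h2⟩
  · rw [Nat.factorization_eq_zero_of_not_dvd h1] at hf' ⊢
    rw [← h2]
    linear_combination primeSymbol ℓ α * hf'
  · rw [Nat.factorization_eq_zero_of_not_dvd h2] at hf' ⊢
    rw [h1]
    linear_combination (-primeSymbol ℓ γ) * hf' - primeSymbol ℓ γ * C.factorization ℓ * h4
  · rw [h1, h2]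
    linear_combination (-primeSymbol ℓ γ) * hf' - primeSymbol ℓ γ * C.factorization ℓ * h4

end CircleMethod

/-! ### The coprime data attached to c + (x+d)i. -/

section Descent

theorem isCoprime_of_prime_eq {p : ℕ} (hp : p.Prime) {x y n : ℤ}
    (h : (p : ℤ) = x ^ 2 + n * y ^ 2) : IsCoprime x y := by
  rw [Int.isCoprime_iff_gcd_eq_one]
  have h1 : ((Int.gcd x y : ℕ) : ℤ) ∣ x := Int.gcd_dvd_left ..
  have h2 : ((Int.gcd x y : ℕ) : ℤ) ∣ y := Int.gcd_dvd_right ..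
  generalize Int.gcd x y = g at h1 h2
  have h3 : ((g * g : ℕ) : ℤ) ∣ p := by
    rw [h]
    push_cast
    rw [← pow_two]
    exact dvd_add (pow_dvd_pow_of_dvd h1 2) ((pow_dvd_pow_of_dvd h2 2).mul_left n)
  have h4 : g * g ∣ p := by exact_mod_cast h3
  rcases (Nat.dvd_prime hp).mp ((dvd_mul_right g g).trans h4) with h5 | h5
  · exact h5
  · rw [h5] at h4
    have := Nat.le_of_dvd hp.pos h4
    have := hp.two_le
    nlinarith

theorem isCoprime_left_of_sq_add {e f N : ℤ} (h : IsCoprime e f) (hN : 2 * N = e ^ 2 + f ^ 2) :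
    IsCoprime e N := by
  have h1 : IsCoprime e (f ^ 2) := h.pow_right
  have h2 : IsCoprime e (2 * N) := by
    rw [hN, pow_two, add_comm]
    exact h1.add_mul_left_right e
  exact h2.of_mul_right_right

/-- g is the gcd of c and x+d, signed to be 1 mod 4. It divides 10y² = c² + (x+d)² - 2x(x+d) and is
prime to 10, so it divides y₀². -/
theorem exists_coprime_data {p : ℕ} (hpp : p.Prime) {c d x y : ℤ}
    (hc : c % 4 = 1) (hx : x % 4 = 1) (hd : 4 ∣ d) (hp : (p : ℤ) = c ^ 2 + d ^ 2)
    (hp' : (p : ℤ) = x ^ 2 + 10 * y ^ 2) (h5 : ¬ (5 ∣ c ∧ 5 ∣ x + d)) :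
    ∃ (g e f y₀ Y₀ : ℤ) (s : ℕ), c = g * f ∧ x + d = g * e ∧ g % 4 = 1 ∧ e % 4 = 1 ∧ f % 4 = 1 ∧
      IsCoprime e f ∧ y = 2 ^ s * y₀ ∧ y₀ % 2 = 1 ∧ Y₀ * g = y₀ ^ 2 ∧ IsCoprime g 5 := by
  obtain ⟨g, hg4, hgc, hgx, hcop⟩ : ∃ g : ℤ, g % 4 = 1 ∧ g ∣ c ∧ g ∣ x + d ∧
      IsCoprime ((x + d) / g) (c / g) := by
    have h1 : ((Int.gcd (x + d) c : ℕ) : ℤ) ∣ x + d := Int.gcd_dvd_left ..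
    have h2 : ((Int.gcd (x + d) c : ℕ) : ℤ) ∣ c := Int.gcd_dvd_right ..
    have h3 : IsCoprime ((x + d) / (Int.gcd (x + d) c : ℕ)) (c / (Int.gcd (x + d) c : ℕ)) :=
      Int.isCoprime_iff_gcd_eq_one.mpr (Int.gcd_ediv_gcd_ediv_gcd (Int.gcd_pos_iff.mpr (by omega)))
    generalize Int.gcd (x + d) c = g at h1 h2 h3
    have ho : g % 2 = 1 := by
      obtain ⟨k, hk⟩ := h2
      by_contra h
      obtain ⟨g', rfl⟩ : ∃ g', g = 2 * g' := ⟨g / 2, by omega⟩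
      have : c = 2 * (g' * k) := by rw [hk]; push_cast; ring
      omega
    rcases (by omega : (g : ℤ) % 4 = 1 ∨ (-g : ℤ) % 4 = 1) with h | h
    · exact ⟨g, h, h2, h1, h3⟩
    · refine ⟨-g, h, (neg_dvd).mpr h2, (neg_dvd).mpr h1, ?_⟩
      rw [Int.ediv_neg, Int.ediv_neg]
      exact h3.neg_neg
  obtain ⟨f, hf⟩ := hgc
  obtain ⟨e, he⟩ := hgx
  have hg0 : g ≠ 0 := by rintro rfl; simp at hg4
  rw [hf, he, Int.mul_ediv_cancel_left _ hg0, Int.mul_ediv_cancel_left _ hg0] at hcop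
  have hy0 : y ≠ 0 := by
    rintro rfl
    have : (p : ℤ) = x ^ 2 := by rw [hp']; ring
    have h2 : p = x.natAbs ^ 2 := by zify; rw [this, sq_abs]
    exact Nat.Prime.not_prime_pow (n := 2) (by norm_num) (h2 ▸ hpp)
  obtain ⟨s, y₀, hs, hyo⟩ : ∃ (s : ℕ) (y₀ : ℤ), y = 2 ^ s * y₀ ∧ y₀ % 2 = 1 := by
    obtain ⟨s, m, hm, h⟩ := Nat.exists_eq_two_pow_mul_odd (Int.natAbs_ne_zero.mpr hy0)
    have hm := Nat.odd_iff.mp hm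
    rcases Int.natAbs_eq y with h' | h'
    · exact ⟨s, m, by rw [h', h]; push_cast; rfl, by omega⟩
    · exact ⟨s, -m, by rw [h', h]; push_cast; ring, by omega⟩
  have h4 : ∀ u : ℤ, (g * u) % 4 = u % 4 := by
    intro u
    rw [Int.mul_emod, hg4, one_mul, Int.emod_emod]
  have hf4 : f % 4 = 1 := by rw [← h4, ← hf]; exact hc
  have he4 : e % 4 = 1 := by rw [← h4, ← he]; omega
  have hg2 : IsCoprime g 2 := ⟨1, -(g / 2), by omega⟩
  have hg5 : IsCoprime g 5 := by
    rw [isCoprime_comm]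
    refine (Nat.prime_iff_prime_int.mp Nat.prime_five).coprime_iff_not_dvd.mpr fun h => h5 ?_
    push_cast at h
    exact ⟨hf ▸ h.mul_right f, he ▸ h.mul_right e⟩
  have hgy : g ∣ y₀ ^ 2 := by
    have h1 : g ∣ 2 * (5 * (2 ^ (2 * s) * y₀ ^ 2)) :=
      ⟨g * (f ^ 2 + e ^ 2) - 2 * x * e, by
        have : y ^ 2 = 2 ^ (2 * s) * y₀ ^ 2 := by rw [hs]; ring
        linear_combination (-10) * this + hp - hp' + (c + g * f) * hf +
          (x + d + g * e - 2 * x) * he⟩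
    exact ((hg2.pow_right (n := 2 * s)).dvd_of_dvd_mul_left
      (hg5.dvd_of_dvd_mul_left (hg2.dvd_of_dvd_mul_left h1)))
  obtain ⟨Y, hY⟩ := hgy
  exact ⟨g, e, f, y₀, Y, s, hf, he, hg4, he4, hf4, hcop, hs, hyo, by rw [hY, mul_comm], hg5⟩

namespace SplitPrime

theorem listChi_pow {M : List SplitPrime} {m : ℤ} (hm : IsCoprime m (listProd M).norm) (k : ℕ) :
    listChi M (m ^ k) = k * listChi M m := by
  induction k with
  | zero =>
    have : listChi M 1 = 0 := by
      rw [listChi]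
      exact List.sum_eq_zero (by simp [chi_one])
    simpa using this
  | succ k ih =>
    rw [pow_succ, listChi_mul hm.pow_left hm, ih]
    push_cast
    ring

theorem chi_neg_one_of_mod_eight {π : SplitPrime} (h8 : π.p % 8 = 1) : π.chi (-1) = 0 := by
  rw [chi_neg_one]
  obtain ⟨k, hk⟩ : ∃ k, (π.p - 1) / 4 = 2 * k := ⟨(π.p - 1) / 8, by omega⟩
  rw [hk]
  push_cast
  rw [← mul_assoc, show (2 : ZMod 4) * 2 = 0 from rfl, zero_mul]

/-- When p ≡ 1 (mod 8), -1 is a quartic residue, so reciprocity needs no normalisation of the sign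
of n. -/
theorem chi_eq_quarticJacobi {π : SplitPrime} (h8 : π.p % 8 = 1) {n : ℤ} (hn : n % 2 = 1)
    (hp : ¬ (π.p : ℤ) ∣ n) : π.chi n = quarticJacobi n.natAbs π.val := by
  have hp' : ¬ π.p ∣ n.natAbs := by rwa [← Int.natCast_dvd]
  rw [← chi_signedNat_eq_quarticJacobi π (by omega) hp']
  have hn0 : (n : ZMod π.p) ≠ 0 := by rwa [Ne, ZMod.intCast_zmod_eq_zero_iff_dvd]
  have h : signedNat n.natAbs = n ∨ signedNat n.natAbs = -1 * n := by
    rcases signedNat_cases (n := n.natAbs) (by omega) with ⟨-, h⟩ | ⟨-, h⟩ <;> omega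
  rcases h with h | h
  · rw [h]
  · rw [h, chi_mul (by simp) hn0, chi_neg_one_of_mod_eight h8, zero_add]

/-- Passage from W to f + ei: the factor 1+i contributes (n-1)/4, and the sign is invisible to the
symbol. -/
theorem quarticJacobi_add_one_add_I {n : ℤ} (hn : n % 4 = 1) {W : GaussianInt} {e f : ℤ}
    (hW : (⟨1, 1⟩ : GaussianInt) * W = ⟨f, e⟩ ∨ (⟨1, 1⟩ : GaussianInt) * W = -⟨f, e⟩)
    (h : IsCoprime n W.norm) :
    quarticJacobi n.natAbs W + ((n - 1) / 4 : ℤ) = quarticJacobi n.natAbs ⟨f, e⟩ := by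
  have h1 : quarticJacobi n.natAbs ((⟨1, 1⟩ : GaussianInt) * W) =
      quarticJacobi n.natAbs ⟨f, e⟩ := by
    rcases hW with hW | hW
    · rw [hW]
    · rw [hW, quarticJacobi_neg]
  have h2 : IsCoprime (n.natAbs : ℤ) (⟨1, 1⟩ : GaussianInt).norm := by
    rw [norm_one_add_I]
    exact ⟨1, -((n.natAbs : ℤ) / 2), by omega⟩
  have h3 : IsCoprime (n.natAbs : ℤ) W.norm := by
    rw [Int.natCast_natAbs]
    exact h.abs_left
  rw [← h1, quarticJacobi_mul (by omega) h2 h3, quarticJacobi_one_add_I (by omega),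
    signedNat_natAbs hn, add_comm]

theorem quarticJacobi_intCast' {n m : ℤ} (hn : n % 2 = 1) (h : IsCoprime n m) :
    quarticJacobi n.natAbs ⟨m, 0⟩ = 0 :=
  quarticJacobi_intCast (n := n.natAbs) (by omega) (m := m)
    (by rw [Int.natCast_natAbs]; exact h.abs_left)

theorem quarticJacobi_smul {n g f e : ℤ} (hn : n % 2 = 1) (hg : IsCoprime n g)
    (h : IsCoprime n (f ^ 2 + e ^ 2)) :
    quarticJacobi n.natAbs ⟨g * f, g * e⟩ = quarticJacobi n.natAbs ⟨f, e⟩ := by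
  have e1 : (⟨g * f, g * e⟩ : GaussianInt) = ⟨g, 0⟩ * ⟨f, e⟩ := by
    apply Zsqrtd.ext <;> simp
  have hn' : ((n.natAbs : ℕ) : ℤ) = |n| := Int.natCast_natAbs n
  rw [e1, quarticJacobi_mul (by omega), quarticJacobi_intCast' hn hg, zero_add]
  · rw [hn', Zsqrtd.norm_def]
    simpa using (hg.mul_right hg).abs_left
  · rw [hn', Zsqrtd.norm_def]
    refine IsCoprime.abs_left ?_
    rw [show f ^ 2 + e ^ 2 = f * f - -1 * e * e by ring] at h
    exact h

end SplitPrime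

end Descent

/-! ### Computing χ(x) - χ(y₀) by reciprocity modulo W. -/

namespace SplitPrime

/-- The descent step: the symbol of `Y₀` modulo `W = (f + e i) / (1 + i)`, where
`c + (x + d) i = g (f + e i)` and `Y₀ g = y₀²`. -/
theorem quarticJacobi_descent {π : SplitPrime} {x g e f y₀ Y₀ : ℤ} {W : GaussianInt}
    (hW : (⟨1, 1⟩ : GaussianInt) * W = ⟨f, e⟩ ∨ (⟨1, 1⟩ : GaussianInt) * W = -⟨f, e⟩)
    (hxy : IsCoprime x y₀) (hπ : y₀ ∣ π.a ^ 2 + π.b ^ 2 - x ^ 2)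
    (ha : π.a = g * f) (hb : x + π.b = g * e) (hy : y₀ % 2 = 1) (hY : Y₀ * g = y₀ ^ 2)
    (hYW : IsCoprime Y₀ W.norm) (he : ∀ q : ℤ, q ∣ g → q ∣ Y₀ → q ∣ x * e)
    (hef : IsCoprime e f) :
    quarticJacobi Y₀.natAbs W = quarticJacobi y₀.natAbs π.val + quarticJacobi g.natAbs ⟨1, 1⟩ := by
  refine quarticJacobi_of_mul_eq_sq (by omega) ?_ fun ℓ hℓ hd => ?_
  · rw [← Int.natAbs_mul, hY, Int.natAbs_pow]
  have : Fact ℓ.Prime := ⟨hℓ⟩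
  have hℓz : Prime (ℓ : ℤ) := Nat.prime_iff_prime_int.mp hℓ
  have h2 : ℓ ≠ 2 := ne_two_of_dvd_odd (n := y₀.natAbs) (by omega) hd
  have hd' : (ℓ : ℤ) ∣ y₀ := Int.natCast_dvd.mpr hd
  have hnx : ¬ (ℓ : ℤ) ∣ x := fun h => hℓz.not_isUnit (hxy.isUnit_of_dvd' h hd')
  have h1i : CoprimeNorm ℓ ⟨1, 1⟩ := by
    rw [CoprimeNorm, norm_one_add_I]
    intro h
    exact h2 ((Nat.prime_dvd_prime_iff_eq hℓ Nat.prime_two).mp (by exact_mod_cast h))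
  have hprod : quarticSymbol ℓ ((⟨1, 1⟩ : GaussianInt) * W) = quarticSymbol ℓ ⟨f, e⟩ := by
    rcases hW with h | h
    · rw [h]
    · rw [h, quarticSymbol_neg]
  simp only [primeSymbol_eq]
  rw [← Int.natCast_dvd, ← Int.natCast_dvd]
  by_cases hg : (ℓ : ℤ) ∣ g
  -- At ℓ ∣ g one has π ≡ -xi, so π has the symbol of i. If also ℓ ∣ Y₀, then ℓ ∣ e, f + ei ≡ f is
  -- rational, and the symbols of W and 1+i cancel.
  · right
    constructor
    · rw [← quarticSymbol_I_eq h2]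
      have hc : (ℓ : ℤ) ∣ π.a := ha ▸ hg.mul_right f
      have hxd : (ℓ : ℤ) ∣ x + π.b := hb ▸ hg.mul_right e
      have e1 : quarticSymbol ℓ π.val = quarticSymbol ℓ (((-x : ℤ) : GaussianInt) * ⟨0, 1⟩) := by
        refine quarticSymbol_congr ?_ ?_
        · simpa [val, Zsqrtd.re_mul] using hc
        · simpa [val, Zsqrtd.im_mul, add_comm] using hxd
      rw [e1, quarticSymbol_mul h2 _ coprimeNorm_I, quarticSymbol_intCast h2, zero_add]
      · simpa using hnx
      · rw [CoprimeNorm, Zsqrtd.norm_def]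
        simpa using fun h => hnx ((hℓz.dvd_or_dvd h).elim id id)
    · by_cases hA : (ℓ : ℤ) ∣ Y₀
      · right
        have hℓe : (ℓ : ℤ) ∣ e := (hℓz.dvd_or_dvd (he _ hg hA)).resolve_left hnx
        have hℓf : ¬ (ℓ : ℤ) ∣ f := fun h => hℓz.not_isUnit (hef.isUnit_of_dvd' hℓe h)
        have hWn : CoprimeNorm ℓ W := fun h => hℓz.not_isUnit (hYW.isUnit_of_dvd' hA h)
        have e2 : quarticSymbol ℓ ⟨f, e⟩ = quarticSymbol ℓ (f : GaussianInt) :=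
          quarticSymbol_congr (by simp) (by simpa using hℓe)
        rw [quarticSymbol_mul h2 h1i hWn, e2, quarticSymbol_intCast h2 hℓf] at hprod
        exact eq_neg_of_add_eq_zero_right hprod
      · left; exact hA
  -- Away from g the circle identity applies: the rational factor g drops out, and twice the symbol
  -- of 1+i cancels that of i.
  · left
    refine ⟨hg, ?_⟩
    have hA : (ℓ : ℤ) ∣ Y₀ := by
      have : (ℓ : ℤ) ∣ Y₀ * g := by rw [hY]; exact hd'.pow (by norm_num)
      exact (hℓz.dvd_or_dvd this).resolve_right hg
    have hWn : CoprimeNorm ℓ W := fun h => hℓz.not_isUnit (hYW.isUnit_of_dvd' hA h)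
    have hfe : CoprimeNorm ℓ ⟨f, e⟩ := by
      have := h1i.mul hWn
      rcases hW with h | h
      · rwa [h] at this
      · rw [h] at this
        rwa [CoprimeNorm, Zsqrtd.norm_neg] at this
    have hgn : CoprimeNorm ℓ (g : GaussianInt) := by
      rw [CoprimeNorm, Zsqrtd.norm_def]
      simpa using fun h => hg ((hℓz.dvd_or_dvd h).elim id id)
    have hsm : (⟨π.a, x + π.b⟩ : GaussianInt) = g * ⟨f, e⟩ := by
      rw [ha, hb]
      apply Zsqrtd.ext <;> simp
    have hw : CoprimeNorm ℓ ⟨π.a, x + π.b⟩ := by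
      rw [hsm]
      exact hgn.mul hfe
    have e3 := two_mul_quarticSymbol h2 (hd'.trans hπ) hnx hw
    rw [hsm, quarticSymbol_mul h2 hgn hfe, quarticSymbol_intCast h2 hg, zero_add, ← hprod,
      quarticSymbol_mul h2 h1i hWn, quarticSymbol_I_eq h2] at e3
    change _ = quarticSymbol ℓ ⟨π.a, π.b⟩
    linear_combination e3

/-- Symbols modulo W are taken on both sides of xe ≡ -5·4^s·Y₀. Reciprocity evaluates those of x, e,
5 and Y₀ (`Sx`, `Se`, `S5`, `SY`); twice that of 2 is that of -1. -/
theorem chi_sub_chi {π : SplitPrime} (h8 : π.p % 8 = 1) {x y g e f y₀ Y₀ : ℤ} {s : ℕ}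
    (hx : x % 4 = 1) (hp : (π.p : ℤ) = x ^ 2 + 10 * y ^ 2)
    (ha : π.a = g * f) (hb : x + π.b = g * e) (hg4 : g % 4 = 1) (he4 : e % 4 = 1)
    (hf4 : f % 4 = 1) (hef : IsCoprime e f) (hy : y = 2 ^ s * y₀) (hyo : y₀ % 2 = 1)
    (hY : Y₀ * g = y₀ ^ 2) (hg5 : IsCoprime g 5) :
    π.chi x - π.chi y₀ = ((x - 1) / 4 : ℤ) + ((x + π.b - 1) / 4 : ℤ) +
      quarticJacobi 5 ⟨π.a, x + π.b⟩ - 1 + (1 + s) * (2 * ((x + π.b - π.a) / 4 : ℤ)) := by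
  obtain ⟨a₁, ha₁⟩ : ∃ a₁, f + e = 2 * a₁ := ⟨(f + e) / 2, by omega⟩
  -- (f + ei)/(1+i) = a₁ + 2b₂i; its imaginary part is even because e ≡ f (mod 4).
  obtain ⟨b₂, hb₂⟩ : ∃ b₂, e - f = 4 * b₂ := ⟨(e - f) / 4, by omega⟩
  have hfa : f = a₁ - 2 * b₂ := by omega
  have hea : e = a₁ + 2 * b₂ := by omega
  have hg0 : g ≠ 0 := by rintro rfl; simp at hg4
  set N : ℤ := a₁ ^ 2 + (2 * b₂) ^ 2 with hN
  have hN2 : 2 * N = e ^ 2 + f ^ 2 := by rw [hN, hfa, hea]; ring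
  -- This is c² + (x+d)² = 2x(x+d) + 10y² divided by 2g.
  have hrel : g * N = x * e + 5 * ((2 ^ s) ^ 2 * Y₀) := by
    have h20 : 2 * g ≠ 0 := mul_ne_zero (by norm_num) hg0
    refine mul_left_cancel₀ h20 ?_
    have hπ := π.norm_eq
    have hy2 : y ^ 2 = (2 ^ s) ^ 2 * y₀ ^ 2 := by rw [hy]; ring
    linear_combination g ^ 2 * hN2 - (π.a + g * f) * ha - (x + π.b + g * e - 2 * x) * hb - hπ + hp
      + 10 * hy2 - 10 * (2 ^ s) ^ 2 * hY
  obtain ⟨M, hM⟩ := exists_list_norm N.natAbs a₁ (2 * b₂)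
    (by rw [Int.natCast_natAbs, abs_of_nonneg (by positivity)])
    (by
      obtain ⟨u, v, huv⟩ := hef
      exact ⟨u + v, u - v, by rw [← huv, hfa, hea]; ring⟩)
    (by
      have : N = a₁ * a₁ + 2 * (2 * b₂ ^ 2) := by rw [hN]; ring
      have h1 : (a₁ * a₁) % 2 = 1 := by rw [Int.mul_emod, show a₁ % 2 = 1 by omega]; rfl
      omega)
    ⟨b₂, rfl⟩
  set W := listProd M with hWdef
  have hW1 : (⟨1, 1⟩ : GaussianInt) * ⟨a₁, 2 * b₂⟩ = ⟨f, e⟩ := by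
    apply Zsqrtd.ext
    · simp only [Zsqrtd.re_mul]; rw [hfa]; ring
    · simp only [Zsqrtd.im_mul]; rw [hea]; ring
  have hW : (⟨1, 1⟩ : GaussianInt) * W = ⟨f, e⟩ ∨ (⟨1, 1⟩ : GaussianInt) * W = -⟨f, e⟩ := by
    rcases hM with h | h
    · left; rw [← h, hW1]
    · right; rw [← hW1, h, mul_neg, neg_neg]
  have hWN : W.norm = N := by
    have h0 : (⟨a₁, 2 * b₂⟩ : GaussianInt).norm = N := by rw [Zsqrtd.norm_def, hN]; ring
    rcases hM with h | h
    · rw [← h, h0]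
    · rw [← h0, h, Zsqrtd.norm_neg]
  have hxy : IsCoprime x y := isCoprime_of_prime_eq π.fact.out hp
  have hx2 : IsCoprime x 2 := ⟨1, -(x / 2), by omega⟩
  have hpx : ∀ q : ℤ, Prime q → q ∣ x → ¬ q ∣ y := fun q hq h1 h2 =>
    hq.not_isUnit (hxy.isUnit_of_dvd' h1 h2)
  have hpz : Prime (π.p : ℤ) := Nat.prime_iff_prime_int.mp π.fact.out
  have hx5 : IsCoprime x 5 := by
    rw [isCoprime_comm]
    have h5 := Nat.prime_iff_prime_int.mp Nat.prime_five
    refine h5.coprime_iff_not_dvd.mpr fun h => ?_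
    push_cast at h
    have h1 : (5 : ℤ) ∣ π.p := by
      rw [hp]
      exact dvd_add (h.pow (by norm_num)) ⟨2 * y ^ 2, by ring⟩
    have h2 : 5 ∣ π.p := by exact_mod_cast h1
    have := (Nat.prime_dvd_prime_iff_eq Nat.prime_five π.fact.out).mp h2
    omega
  have hxy₀ : IsCoprime x y₀ := by rw [hy] at hxy; exact hxy.of_mul_right_right
  have hxY : IsCoprime x Y₀ := by
    have h1 : IsCoprime x (y₀ ^ 2) := hxy₀.pow_right
    rw [← hY] at h1
    exact h1.of_mul_right_left
  have hxgN : IsCoprime x (g * N) := by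
    rw [hrel, add_comm]
    exact (hx5.mul_right ((hx2.pow_right.pow_right).mul_right hxY)).add_mul_left_right e
  have hxg : IsCoprime x g := hxgN.of_mul_right_left
  have hxN : IsCoprime x N := hxgN.of_mul_right_right
  have heN : IsCoprime e N := isCoprime_left_of_sq_add hef hN2
  have h5YN : IsCoprime (5 * ((2 ^ s) ^ 2 * Y₀)) N := by
    have h1 : IsCoprime (x * e) N := hxN.mul_left heN
    have h2 : 5 * ((2 ^ s) ^ 2 * Y₀) = -(x * e) + N * g := by linear_combination -hrel
    rw [h2]
    exact h1.neg_left.add_mul_left_left g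
  have h5N : IsCoprime 5 N := h5YN.of_mul_left_left
  have hYN : IsCoprime Y₀ N := h5YN.of_mul_left_right.of_mul_left_right
  have hNodd := (listChi_neg_one M).1
  rw [← hWdef, hWN] at hNodd
  have h2N : IsCoprime 2 N := ⟨-(N / 2), 1, by omega⟩
  have hxp : ¬ (π.p : ℤ) ∣ x := by
    intro h
    have h1 : (π.p : ℤ) ∣ 10 * y ^ 2 := by
      have : (10 * y ^ 2 : ℤ) = π.p - x ^ 2 := by rw [hp]; ring
      rw [this]
      exact dvd_sub dvd_rfl (h.pow (by norm_num))
    rcases hpz.dvd_or_dvd h1 with h2 | h2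
    · have h3 : π.p ∣ 2 * 5 := by exact_mod_cast h2
      rcases (Nat.Prime.dvd_mul π.fact.out).mp h3 with h3 | h3
      · have := (Nat.prime_dvd_prime_iff_eq π.fact.out Nat.prime_two).mp h3; omega
      · have := (Nat.prime_dvd_prime_iff_eq π.fact.out Nat.prime_five).mp h3; omega
    · exact hpx _ hpz h (hpz.dvd_of_dvd_pow h2)
  have hyp : ¬ (π.p : ℤ) ∣ y₀ := by
    intro h
    have hpy : (π.p : ℤ) ∣ y := hy ▸ h.mul_left _
    have h1 : (π.p : ℤ) ∣ x ^ 2 := by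
      have : x ^ 2 = π.p - 10 * y ^ 2 := by rw [hp]; ring
      rw [this]
      exact dvd_sub dvd_rfl ((hpy.pow (by norm_num)).mul_left _)
    exact hxp (hpz.dvd_of_dvd_pow h1)
  have hef2 : f ^ 2 + e ^ 2 = 2 * N := by rw [hN2]; ring
  -- Modulo x, g(f + ei) = c + (x+d)i is congruent to π.
  have Sx : listChi M x + ((x - 1) / 4 : ℤ) = π.chi x := by
    rw [listChi_eq_quarticJacobi hx (by rw [← hWdef, hWN]; exact hxN),
      quarticJacobi_add_one_add_I hx hW (by rw [hWN]; exact hxN),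
      ← quarticJacobi_smul (g := g) (by omega) hxg (by rw [hef2]; exact hx2.mul_right hxN),
      chi_eq_quarticJacobi h8 (by omega) hxp, ← ha, ← hb]
    exact quarticJacobi_congr (by simp [val]) (by simp [val])
  -- Modulo e, f + ei is the rational integer f.
  have Se : listChi M e + ((e - 1) / 4 : ℤ) = 0 := by
    rw [listChi_eq_quarticJacobi he4 (by rw [← hWdef, hWN]; exact heN),
      quarticJacobi_add_one_add_I he4 hW (by rw [hWN]; exact heN),
      ← quarticJacobi_intCast' (by omega) hef]
    exact quarticJacobi_congr (by simp) (by simp)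
  have S5 : listChi M 5 + 1 = quarticJacobi 5 ⟨π.a, x + π.b⟩ := by
    have h1 := quarticJacobi_add_one_add_I (n := 5) (by norm_num) hW (by rw [hWN]; exact h5N)
    have h2 := quarticJacobi_smul (n := 5) (g := g) (f := f) (e := e) (by norm_num) hg5.symm
      (by rw [hef2]; exact IsCoprime.mul_right ⟨1, -2, by norm_num⟩ h5N)
    rw [listChi_eq_quarticJacobi (by norm_num) (by rw [← hWdef, hWN]; exact h5N), ha, hb]
    -- The summand 1 is (5-1)/4, from the factor 1+i.
    change quarticJacobi 5 W + 1 = _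
    change quarticJacobi 5 W + ((1 : ℤ) : ZMod 4) = _ at h1
    rw [Int.cast_one] at h1
    exact h1.trans h2.symm
  have hY4 : Y₀ % 4 = 1 := by
    have h1 : (Y₀ * g) % 4 = Y₀ % 4 := by rw [Int.mul_emod, hg4, mul_one, Int.emod_emod]
    have h2 : y₀ ^ 2 % 4 = 1 := by
      obtain ⟨k, hk⟩ : ∃ k, y₀ = 2 * k + 1 := ⟨y₀ / 2, by omega⟩
      have : y₀ ^ 2 = 4 * (k ^ 2 + k) + 1 := by rw [hk]; ring
      omega
    rw [← h1, hY, h2]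
  have SY : listChi M Y₀ = π.chi y₀ + ((g - 1) / 4 : ℤ) := by
    rw [listChi_eq_quarticJacobi hY4 (by rw [← hWdef, hWN]; exact hYN),
      chi_eq_quarticJacobi h8 hyo hyp,
      quarticJacobi_descent hW hxy₀ ?_ ha hb hyo hY (by rw [hWN]; exact hYN) ?_ hef,
      quarticJacobi_one_add_I (by omega), signedNat_natAbs hg4]
    · rw [← π.norm_eq, hp, hy]
      exact ⟨10 * (2 ^ s) ^ 2 * y₀, by ring⟩
    · intro q h1 h2
      rw [show x * e = g * N - 5 * ((2 ^ s) ^ 2 * Y₀) by linear_combination -hrel]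
      exact dvd_sub (h1.mul_right _) ((h2.mul_left _).mul_left _)
  have hsum : listChi M x + listChi M e =
      listChi M (-1) + (listChi M 5 + ((2 * s : ℕ) * listChi M 2 + listChi M Y₀)) := by
    have h1 : listChi M (x * e) = listChi M (-1 * (5 * (2 ^ (2 * s) * Y₀))) := by
      refine listChi_congr ?_
      rw [← hWdef, hWN]
      exact ⟨g, by rw [pow_mul']; linear_combination -hrel⟩
    rw [← hWN] at hxN heN h5N h2N hYN
    have h2s : IsCoprime (2 ^ (2 * s)) W.norm := h2N.pow_left
    rw [← listChi_mul hxN heN, h1,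
      listChi_mul isCoprime_one_left.neg_left (h5N.mul_left (h2s.mul_left hYN)),
      listChi_mul h5N (h2s.mul_left hYN), listChi_mul h2s hYN, listChi_pow h2N]
  have h2sum := two_mul_listChi_two M
  -- (N-1)/4 ≡ b₂² and (x+d-c)/4 = gb₂ have the same parity, g being odd.
  have hneg : listChi M (-1) = 2 * ((x + π.b - π.a) / 4 : ℤ) := by
    rw [(listChi_neg_one M).2, ← hWdef, hWN]
    obtain ⟨k, hk⟩ : ∃ k, a₁ = 2 * k + 1 := ⟨a₁ / 2, by omega⟩
    obtain ⟨G, hG⟩ : ∃ G, g = 4 * G + 1 := ⟨g / 4, by omega⟩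
    obtain ⟨u, hu⟩ := (Int.even_mul_succ_self k).two_dvd
    obtain ⟨v, hv⟩ := (Int.even_mul_succ_self b₂).two_dvd
    have h1 : N - 1 = 4 * (2 * u + b₂ ^ 2) := by rw [hN, hk, ← hu]; ring
    have h2 : x + π.b - π.a = 4 * (g * b₂) := by linear_combination hb - ha + g * hb₂
    rw [h1, h2, Int.mul_ediv_cancel_left _ (by norm_num), Int.mul_ediv_cancel_left _ (by norm_num),
      hG, show b₂ ^ 2 = 2 * v - b₂ by rw [← hv]; ring]
    push_cast
    have h4 : (4 : ZMod 4) = 0 := rfl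
    linear_combination ((u : ZMod 4) + v - b₂ - 2 * G * b₂) * h4
  have hxb : (((x + π.b - 1) / 4 : ℤ) : ZMod 4) = ((g - 1) / 4 : ℤ) + ((e - 1) / 4 : ℤ) := by
    rw [hb, cast_sub_one_div_four_mul hg4 he4]
  rw [hxb, ← hneg]
  push_cast at hsum ⊢
  linear_combination (-1 : ZMod 4) * Sx - Se + hsum + S5 + SY + (s : ZMod 4) * h2sum

end SplitPrime

/-! ### The octic symbols of 2 and of -5. -/

namespace SplitPrime

theorem isCoprime_a_b (π : SplitPrime) : IsCoprime π.a π.b :=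
  isCoprime_of_prime_eq π.fact.out (n := 1) (by rw [π.norm_eq]; ring)

theorem intCast_ne_zero_of_dvd_b {π : SplitPrime} {n : ℤ} (h : n ∣ π.b) :
    (n : ZMod π.p) ≠ 0 := by
  intro h0
  obtain ⟨k, hk⟩ := h
  refine π.b_ne_zero ?_
  rw [hk, Int.cast_mul, h0, zero_mul]

/-- Modulo a divisor of b, π is the rational integer a. -/
theorem chi_of_odd_dvd_b {π : SplitPrime} (h8 : π.p % 8 = 1) {n : ℤ} (hn : n % 2 = 1)
    (h : n ∣ π.b) : π.chi n = 0 := by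
  have hp : ¬ (π.p : ℤ) ∣ n := by
    rw [← ZMod.intCast_zmod_eq_zero_iff_dvd]
    exact intCast_ne_zero_of_dvd_b h
  have hc : IsCoprime n π.a := (π.isCoprime_a_b.symm).of_isCoprime_of_dvd_left h
  rw [chi_eq_quarticJacobi h8 hn hp, ← quarticJacobi_intCast' hn hc]
  exact quarticJacobi_congr (by simp [val]) (by simpa [val] using h)

theorem a_sub_b_ne_zero (π : SplitPrime) : ((π.a - π.b : ℤ) : ZMod π.p) ≠ 0 := by
  intro h
  push_cast at h
  have h1 := π.a_add_b_mul_imag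
  have h2 : (π.b : ZMod π.p) * (1 + π.imag) = 0 := by linear_combination h1 - h
  rcases mul_eq_zero.mp h2 with h3 | h3
  · exact π.b_ne_zero h3
  · exact π.two_ne_zero (by linear_combination (1 - π.imag) * h3 + π.imag_mul_self)

/-- Modulo a - b, π ≡ b(1+i), and only 1+i contributes. -/
theorem chi_a_sub_b {π : SplitPrime} (h8 : π.p % 8 = 1) (ha : π.a % 4 = 1) (hb : 4 ∣ π.b) :
    π.chi (π.a - π.b) = ((π.a - π.b - 1) / 4 : ℤ) := by
  have h4 : (π.a - π.b) % 4 = 1 := by omega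
  have hp : ¬ (π.p : ℤ) ∣ π.a - π.b := by
    rw [← ZMod.intCast_zmod_eq_zero_iff_dvd]
    exact π.a_sub_b_ne_zero
  have hc : IsCoprime (π.a - π.b) π.b := by
    have := π.isCoprime_a_b.add_mul_left_left (-1)
    rwa [mul_neg_one, ← sub_eq_add_neg] at this
  have hc2 : IsCoprime (π.a - π.b) (1 ^ 2 + 1 ^ 2) := ⟨1, -((π.a - π.b) / 2), by omega⟩
  rw [chi_eq_quarticJacobi h8 (by omega) hp]
  have h1 : quarticJacobi (π.a - π.b).natAbs π.val =
      quarticJacobi (π.a - π.b).natAbs ⟨π.b * 1, π.b * 1⟩ :=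
    quarticJacobi_congr (by simp [val]) (by simp [val])
  rw [h1, quarticJacobi_smul (by omega) hc hc2, quarticJacobi_one_add_I (by omega),
    signedNat_natAbs h4]

theorem pow_eq_pow_chi {π : SplitPrime} (h8 : π.p % 8 = 1) {n : ℤ} (hn : (n : ZMod π.p) ≠ 0) :
    ((n : ZMod π.p) ^ 2) ^ ((π.p - 1) / 8) = π.imag ^ (π.chi n).val := by
  rw [imag_pow_chi hn, ← pow_mul]
  congr 1
  omega

theorem two_pow_aux {π : SplitPrime} (h8 : π.p % 8 = 1) {C D : ℤ} (ha : π.a = 4 * C + 1)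
    (hb : π.b = 4 * D) :
    (2 : ZMod π.p) ^ ((π.p - 1) / 8) = π.imag ^ (2 * (C : ZMod 4) + D - π.chi π.b).val := by
  have hI := π.imag_mul_self
  have h1 := π.a_add_b_mul_imag
  have hm : (((π.p - 1) / 8 : ℕ) : ℤ) = 2 * C ^ 2 + C + 2 * D ^ 2 := by
    have : (π.p : ℤ) = 8 * (2 * C ^ 2 + C + 2 * D ^ 2) + 1 := by rw [π.norm_eq, ha, hb]; ring
    omega
  -- Modulo π, a = -bi, so a - b = -b(1+i), and i³(1+i)² = 2.
  have h2 : (2 : ZMod π.p) * (π.b : ZMod π.p) ^ 2 =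
      π.imag ^ 3 * ((π.a - π.b : ℤ) : ZMod π.p) ^ 2 := by
    have e : ((π.a - π.b : ℤ) : ZMod π.p) = -(π.b : ZMod π.p) * (1 + π.imag) := by
      push_cast
      linear_combination h1
    rw [e]
    linear_combination
      (-(π.b : ZMod π.p) ^ 2 * (π.imag ^ 3 + 2 * π.imag ^ 2 - 2)) * hI
  have h3 := congrArg (· ^ ((π.p - 1) / 8)) h2
  simp only [mul_pow _ _ ((π.p - 1) / 8)] at h3
  rw [pow_eq_pow_chi h8 π.b_ne_zero, pow_eq_pow_chi h8 π.a_sub_b_ne_zero, ← pow_mul,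
    ← pow_val_natCast hI (3 * ((π.p - 1) / 8)), ← pow_val_add hI, chi_a_sub_b h8 (by omega) ⟨D, hb⟩] at h3
  have hI0 : π.imag ^ (π.chi π.b).val ≠ 0 := by
    refine pow_ne_zero _ ?_
    intro h
    rw [h] at hI
    simp at hI
  refine mul_right_cancel₀ hI0 (h3.trans ?_)
  rw [← pow_val_add hI]
  congr 2
  rw [show (π.a - π.b - 1) / 4 = C - D by omega]
  have hm' := congrArg (Int.cast (R := ZMod 4)) hm
  obtain ⟨u, hu⟩ := (Int.even_mul_succ_self C).two_dvd
  obtain ⟨v, hv⟩ := (Int.even_mul_succ_self D).two_dvd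
  have hu' := congrArg (Int.cast (R := ZMod 4)) hu
  have hv' := congrArg (Int.cast (R := ZMod 4)) hv
  rw [Int.cast_natCast] at hm'
  push_cast at hm' hu' hv' ⊢
  have h4 : (4 : ZMod 4) = 0 := rfl
  linear_combination 3 * hm' + 6 * hu' + 6 * hv' + (3 * (u : ZMod 4) + 3 * v - C - 2 * D) * h4

theorem chi_two_of_mod_eight {π : SplitPrime} (h8 : π.p % 8 = 1) {C D : ℤ} (ha : π.a = 4 * C + 1)
    (hb : π.b = 4 * D) : π.chi 2 = 2 * D ∧ π.chi π.b = 0 := by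
  have hI := π.imag_mul_self
  have h4 : (4 : ZMod 4) = 0 := rfl
  have h2 : ((2 : ℤ) : ZMod π.p) ≠ 0 := by exact_mod_cast π.two_ne_zero
  have h22 : 2 * π.chi 2 = 0 := by rw [two_mul_chi_two, chi_neg_one_of_mod_eight h8]
  have hb0 : π.b ≠ 0 := by
    intro h
    exact π.b_ne_zero (by rw [h, Int.cast_zero])
  obtain ⟨r, m, hm, h⟩ := Nat.exists_eq_two_pow_mul_odd (Int.natAbs_ne_zero.mpr hb0)
  obtain ⟨b₀, hbo, hbr⟩ : ∃ b₀ : ℤ, b₀ % 2 = 1 ∧ π.b = 2 ^ r * b₀ := by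
    have hm := Nat.odd_iff.mp hm
    rcases Int.natAbs_eq π.b with h' | h'
    · exact ⟨m, by omega, by rw [h', h]; push_cast; rfl⟩
    · exact ⟨-m, by omega, by rw [h', h]; push_cast; ring⟩
  have hchib : π.chi π.b = r * π.chi 2 := by
    have h1 : ((2 ^ r : ℤ) : ZMod π.p) ≠ 0 := intCast_ne_zero_of_dvd_b ⟨b₀, hbr⟩
    have h3 : b₀ ∣ π.b := ⟨2 ^ r, by rw [hbr, mul_comm]⟩
    conv_lhs => rw [hbr]
    rw [chi_mul h1 (intCast_ne_zero_of_dvd_b h3), chi_pow h2, chi_of_odd_dvd_b h8 hbo h3, add_zero]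
  -- Squaring `two_pow_aux` gives χ(2) = 4C + 2D - 2χ(b), and 2χ(b) = r·2χ(2) = 0.
  have hchi2 : π.chi 2 = 2 * D := by
    have h1 := congrArg (· ^ 2) (two_pow_aux h8 ha hb)
    rw [← pow_mul, ← pow_mul, mul_comm, pow_mul] at h1
    have h3 := pow_eq_pow_chi h8 h2
    rw [Int.cast_ofNat, h1, mul_comm, pow_mul, pow_two, mul_pow, ← pow_val_add hI] at h3
    have := pow_val_injective hI π.two_ne_zero h3
    rw [← this, hchib]
    linear_combination (C : ZMod 4) * h4 - (r : ZMod 4) * h22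
  refine ⟨hchi2, ?_⟩
  rw [hchib]
  -- 4 ∣ b forces r ≥ 2. For r = 2, 2χ(2) = 0; for r ≥ 3, D is even and χ(2) itself is 0.
  match r, hbr with
  | 0, hbr => omega
  | 1, hbr => omega
  | 2, hbr => push_cast; exact h22
  | r + 3, hbr =>
    have hD : D = 2 * (2 ^ r * b₀) := by
      have : 4 * D = 4 * (2 * (2 ^ r * b₀)) := by rw [← hb, hbr]; ring
      omega
    rw [hchi2, hD]
    push_cast
    linear_combination ((r + 3 : ZMod 4) * (2 ^ r * b₀)) * h4

theorem two_pow_eq {π : SplitPrime} (h8 : π.p % 8 = 1) {C D : ℤ} (ha : π.a = 4 * C + 1)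
    (hb : π.b = 4 * D) :
    (2 : ZMod π.p) ^ ((π.p - 1) / 8) = π.imag ^ (2 * (C : ZMod 4) + D).val := by
  rw [two_pow_aux h8 ha hb, (chi_two_of_mod_eight h8 ha hb).2, sub_zero]

/-- The octic symbol of `-5`, when `x ≡ 1 (mod 4)`. -/
theorem neg_five_pow {π : SplitPrime} (h8 : π.p % 8 = 1) (ha : π.a % 4 = 1) (hb : 4 ∣ π.b)
    {x y : ℤ} (hp : (π.p : ℤ) = x ^ 2 + 10 * y ^ 2) (hx : x % 4 = 1) (hy : 2 ∣ y)
    (h5 : ¬ (5 ∣ π.a ∧ 5 ∣ x + π.b)) :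
    (-5 : ZMod π.p) ^ ((π.p - 1) / 8) = π.imag ^ (quarticJacobi 5 ⟨π.a, x + π.b⟩ - 1 +
      2 * (π.b / 4 : ℤ) + 2 * (y / 2 : ℤ)).val := by
  obtain ⟨g, e, f, y₀, Y₀, s, h1, h2, hg4, he4, hf4, hef, hys, hyo, hY, hg5⟩ :=
    exists_coprime_data π.fact.out ha hx hb π.norm_eq hp h5
  have key := chi_sub_chi h8 hx hp h1 h2 hg4 he4 hf4 hef hys hyo hY hg5
  obtain ⟨C, hC⟩ : ∃ C, π.a = 4 * C + 1 := ⟨π.a / 4, by omega⟩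
  obtain ⟨D, hD⟩ := hb
  obtain ⟨X, hX⟩ : ∃ X, x = 4 * X + 1 := ⟨x / 4, by omega⟩
  obtain ⟨Y, hYy⟩ := hy
  have hI := π.imag_mul_self
  have hI0 : π.imag ≠ 0 := by
    intro h
    rw [h] at hI
    simp at hI
  have hpz : Prime (π.p : ℤ) := Nat.prime_iff_prime_int.mp π.fact.out
  have hxy : IsCoprime x y := isCoprime_of_prime_eq π.fact.out hp
  have hyp : (y : ZMod π.p) ≠ 0 := by
    rw [Ne, ZMod.intCast_zmod_eq_zero_iff_dvd]
    intro h
    have h3 : (π.p : ℤ) ∣ x ^ 2 := by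
      have : x ^ 2 = π.p - 10 * y ^ 2 := by rw [hp]; ring
      rw [this]
      exact dvd_sub dvd_rfl ((h.pow (by norm_num)).mul_left _)
    exact hpz.not_isUnit (hxy.isUnit_of_dvd' (hpz.dvd_of_dvd_pow h3) h)
  have hrel : (x : ZMod π.p) ^ 2 = -5 * 2 * (y : ZMod π.p) ^ 2 := by
    have h : ((π.p : ℤ) : ZMod π.p) = ((x ^ 2 + 10 * y ^ 2 : ℤ) : ZMod π.p) := by rw [← hp]
    push_cast at h
    rw [CharP.cast_eq_zero] at h
    linear_combination -h
  have hxp : (x : ZMod π.p) ≠ 0 := by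
    intro h
    have h3 : ((10 : ℤ) : ZMod π.p) ≠ 0 := by
      rw [Ne, ZMod.intCast_zmod_eq_zero_iff_dvd]
      intro h
      have h3 : π.p ∣ 2 * 5 := by exact_mod_cast h
      rcases (Nat.Prime.dvd_mul π.fact.out).mp h3 with h3 | h3
      · have := (Nat.prime_dvd_prime_iff_eq π.fact.out Nat.prime_two).mp h3; omega
      · have := (Nat.prime_dvd_prime_iff_eq π.fact.out Nat.prime_five).mp h3; omega
    push_cast at h3
    refine mul_ne_zero h3 (pow_ne_zero 2 hyp) ?_
    rw [h] at hrel
    linear_combination hrel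
  obtain ⟨hchi2, -⟩ := chi_two_of_mod_eight h8 hC hD
  have hchiy : π.chi y = s * (2 * D) + π.chi y₀ := by
    have h3 : ((2 ^ s : ℤ) : ZMod π.p) * (y₀ : ZMod π.p) ≠ 0 := by
      rw [← Int.cast_mul, ← hys]; exact hyp
    rw [hys, chi_mul (left_ne_zero_of_mul h3) (right_ne_zero_of_mul h3),
      chi_pow (by exact_mod_cast π.two_ne_zero), hchi2]
  have h3 := congrArg (· ^ ((π.p - 1) / 8)) hrel
  simp only [mul_pow _ _ ((π.p - 1) / 8)] at h3
  rw [pow_eq_pow_chi h8 hxp, pow_eq_pow_chi h8 hyp, two_pow_eq h8 hC hD, mul_assoc,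
    ← pow_val_add hI] at h3
  refine mul_right_cancel₀ (pow_ne_zero (2 * (C : ZMod 4) + D + π.chi y).val hI0) (h3.symm.trans ?_)
  rw [← pow_val_add hI]
  congr 2
  have h4 : (4 : ZMod 4) = 0 := rfl
  -- y is even, so s ≥ 1; for s ≥ 2 the half Y = y/2 is even too.
  have hsY : (2 : ZMod 4) * Y * (1 - s) = 0 := by
    match s, hys with
    | 0, hys => omega
    | 1, _ => push_cast; ring
    | s + 2, hys =>
      have : Y = 2 * (2 ^ s * y₀) := by
        have : 2 * Y = 2 * (2 * (2 ^ s * y₀)) := by rw [← hYy, hys]; ring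
        omega
      rw [this]
      push_cast
      linear_combination ((2 ^ s * y₀) * (1 - (s + 2 : ZMod 4))) * h4
  -- Equate the two values of (p-1)/8 and double: in ℤ/4 what remains is 2X + 2Y² = 2C, and Y² ≡ Y
  -- (mod 2).
  have hXC : (2 : ZMod 4) * (X - C) = 2 * Y := by
    have h5 : 2 * X ^ 2 + X + 5 * Y ^ 2 = 2 * C ^ 2 + C + 2 * D ^ 2 := by
      have h6 : x ^ 2 + 10 * y ^ 2 = π.a ^ 2 + π.b ^ 2 := by rw [← hp, π.norm_eq]
      rw [hX, hYy, hC, hD] at h6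
      linarith
    obtain ⟨u, hu⟩ := (Int.even_mul_succ_self Y).two_dvd
    have h5' := congrArg (Int.cast (R := ZMod 4)) h5
    have hu' := congrArg (Int.cast (R := ZMod 4)) hu
    push_cast at h5' hu'
    linear_combination 2 * h5' - 10 * hu' +
      ((C : ZMod 4) ^ 2 + D ^ 2 - X ^ 2 - 5 * u + 2 * Y) * h4
  rw [show (x - 1) / 4 = X by omega, show (x + π.b - 1) / 4 = X + D by omega,
    show (x + π.b - π.a) / 4 = X + D - C by omega] at key
  rw [show π.b / 4 = D by omega, show y / 2 = Y by omega, hchiy]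
  push_cast at key ⊢
  linear_combination key + (s : ZMod 4) * hXC - hsY + ((X : ZMod 4) - C) * h4

end SplitPrime

/-! ### Representation of p by x² + 10y². -/

section RepresentationByForm

theorem exists_sq_eq_neg_ten {p : ℕ} [Fact p.Prime] (hp : p ≡ 1 [MOD 40] ∨ p ≡ 9 [MOD 40]) :
    ∃ z : ZMod p, z ^ 2 = -10 := by
  have h40 : p % 40 = 1 ∨ p % 40 = 9 := hp
  obtain ⟨a, ha⟩ := (ZMod.exists_sq_eq_neg_one_iff (p := p)).mpr (by omega)
  obtain ⟨b, hb⟩ := (ZMod.exists_sq_eq_two_iff (p := p) (by omega)).mpr (by omega)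
  obtain ⟨c, hc⟩ : IsSquare ((5 : ℕ) : ZMod p) := by
    rw [ZMod.exists_sq_eq_prime_iff_of_mod_four_eq_one (by omega) (by norm_num)]
    rcases h40 with h | h
    · have : ((p : ℕ) : ZMod 5) = 1 := by
        rw [← Nat.mod_add_div p 40, h]
        push_cast
        rw [show (40 : ZMod 5) = 0 from rfl]
        ring
      rw [this]
      exact ⟨1, by norm_num⟩
    · have : ((p : ℕ) : ZMod 5) = 9 := by
        rw [← Nat.mod_add_div p 40, h]
        push_cast
        rw [show (40 : ZMod 5) = 0 from rfl]
        ring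
      rw [this]
      exact ⟨3, by norm_num⟩
  push_cast at hc
  exact ⟨a * b * c, by linear_combination (-10) * ha - a ^ 2 * 5 * hb - a ^ 2 * b ^ 2 * hc⟩

/-- **Thue's lemma**. -/
theorem exists_small_solution {p : ℕ} [hp : Fact p.Prime] (z : ZMod p) :
    ∃ x y : ℤ, (x, y) ≠ (0, 0) ∧ (x : ZMod p) = z * y ∧ x ^ 2 < p ∧ y ^ 2 < p := by
  set k := Nat.sqrt p with hk
  have h1 : k * k ≤ p := Nat.sqrt_le p
  have h2 : p < (k + 1) * (k + 1) := Nat.lt_succ_sqrt p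
  have h3 : k * k < p := by
    refine lt_of_le_of_ne h1 fun h => ?_
    exact Nat.Prime.not_prime_pow (x := k) (n := 2) (by norm_num) (by rw [pow_two, h]; exact hp.out)
  let F : Fin (k + 1) × Fin (k + 1) → ZMod p := fun u => (u.1 : ℕ) - z * (u.2 : ℕ)
  obtain ⟨u, v, huv, hF⟩ := Fintype.exists_ne_map_eq_of_card_lt F (by
    rw [ZMod.card, Fintype.card_prod, Fintype.card_fin]; exact h2)
  have hb : ∀ m n : Fin (k + 1), (((m : ℕ) : ℤ) - (n : ℕ)) ^ 2 < p := by
    intro m n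
    have hm := m.is_lt
    have hn := n.is_lt
    have h4 : |((m : ℕ) : ℤ) - (n : ℕ)| ≤ k := by rw [abs_le]; omega
    have h5 := sq_le_sq' (by have := abs_nonneg (((m : ℕ) : ℤ) - (n : ℕ)); omega) h4
    rw [sq_abs] at h5
    have h6 : ((k : ℤ)) ^ 2 < p := by rw [pow_two]; exact_mod_cast h3
    exact lt_of_le_of_lt h5 h6
  refine ⟨(u.1 : ℕ) - (v.1 : ℕ), (u.2 : ℕ) - (v.2 : ℕ), ?_, ?_, hb _ _, hb _ _⟩
  · intro h
    rw [Prod.mk.injEq] at h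
    apply huv
    apply Prod.ext <;> apply Fin.ext <;> omega
  · simp only [F] at hF
    push_cast
    linear_combination hF

theorem sq_mod_five (x : ℤ) : x ^ 2 % 5 = 0 ∧ 5 ∣ x ∨ x ^ 2 % 5 = 1 ∨ x ^ 2 % 5 = 4 := by
  rw [pow_two, Int.mul_emod]
  rcases (by omega : x % 5 = 0 ∨ x % 5 = 1 ∨ x % 5 = 2 ∨ x % 5 = 3 ∨ x % 5 = 4) with
    h | h | h | h | h <;> rw [h] <;> omega

theorem sq_mod_eight (x : ℤ) : x ^ 2 % 8 = 0 ∧ 2 ∣ x ∨ x ^ 2 % 8 = 4 ∧ 2 ∣ x ∨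
    x ^ 2 % 8 = 1 ∧ x % 2 = 1 := by
  rw [pow_two, Int.mul_emod]
  rcases (by omega : x % 8 = 0 ∨ x % 8 = 1 ∨ x % 8 = 2 ∨ x % 8 = 3 ∨ x % 8 = 4 ∨ x % 8 = 5 ∨
    x % 8 = 6 ∨ x % 8 = 7) with
    h | h | h | h | h | h | h | h <;> rw [h] <;> omega

theorem sq_mod_three (x : ℤ) : x ^ 2 % 3 = 0 ∧ 3 ∣ x ∨ x ^ 2 % 3 = 1 := by
  rw [pow_two, Int.mul_emod]
  rcases (by omega : x % 3 = 0 ∨ x % 3 = 1 ∨ x % 3 = 2) with h | h | h <;> rw [h] <;> omega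

/-- Thue's lemma gives x² + 10y² = Kp with 0 < K < 11, and squares modulo 5 leave K = 1, 4, 5, 6, 9,
10. The values 5 and 6 (the other genus) fail modulo 8; 4 and 9 divide out a square; 10 swaps the
roles of x and y. -/
theorem exists_eq_sq_add_ten_mul_sq {p : ℕ} [hp : Fact p.Prime]
    (h : p ≡ 1 [MOD 40] ∨ p ≡ 9 [MOD 40]) : ∃ x y : ℤ, (p : ℤ) = x ^ 2 + 10 * y ^ 2 := by
  have h40 : p % 40 = 1 ∨ p % 40 = 9 := h
  obtain ⟨z, hz⟩ := exists_sq_eq_neg_ten h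
  obtain ⟨x, y, hne, hxy, hx, hy⟩ := exists_small_solution z
  have hd : (p : ℤ) ∣ x ^ 2 + 10 * y ^ 2 := by
    rw [← ZMod.intCast_zmod_eq_zero_iff_dvd]
    push_cast
    rw [hxy]
    linear_combination (y : ZMod p) ^ 2 * hz
  obtain ⟨K, hK⟩ := hd
  have hp0 : (0 : ℤ) < p := by exact_mod_cast hp.out.pos
  have hK11 : K < 11 := by nlinarith
  have hpos : 0 < x ^ 2 + 10 * y ^ 2 := by
    have hx0 := sq_nonneg x
    have hy0 := sq_nonneg y
    by_contra hcon
    have h1 : x ^ 2 = 0 := by omega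
    have h2 : y ^ 2 = 0 := by omega
    rw [sq_eq_zero_iff] at h1 h2
    exact hne (by rw [h1, h2])
  have hK0 : 0 < K := by
    rw [hK] at hpos
    exact (pos_iff_pos_of_mul_pos hpos).mp hp0
  have hp5 : (p : ℤ) % 5 = 1 ∨ (p : ℤ) % 5 = 4 := by omega
  have hp8 : (p : ℤ) % 8 = 1 := by omega
  clear h40 hx hy hxy hz hpos
  have x5 := sq_mod_five x
  have hK5 : K % 5 = 0 ∨ K % 5 = 1 ∨ K % 5 = 4 := by
    have h1 : ((p : ℤ) * K) % 5 = x ^ 2 % 5 := by omega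
    rw [Int.mul_emod] at h1
    rcases hp5 with h | h <;> rw [h] at h1 <;> omega
  rcases (by omega : K = 1 ∨ K = 4 ∨ K = 5 ∨ K = 6 ∨ K = 9 ∨ K = 10) with
    rfl | rfl | rfl | rfl | rfl | rfl
  · exact ⟨x, y, by linarith⟩
  · clear x5 hp5 hK5
    obtain ⟨a, rfl⟩ : 2 ∣ x := by
      have x8 := sq_mod_eight x
      omega
    obtain ⟨b, rfl⟩ : 2 ∣ y := by
      have y8 := sq_mod_eight y
      have : (2 * a) ^ 2 = 4 * a ^ 2 := by ring
      omega
    exact ⟨a, b, by linarith⟩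
  · obtain ⟨a, rfl⟩ : 5 ∣ x := by omega
    have h2 : (p : ℤ) = 5 * a ^ 2 + 2 * y ^ 2 := by linarith
    have a8 := sq_mod_eight a
    have y8 := sq_mod_eight y
    clear x5 hp5 hK5 hK
    omega
  · clear x5 hp5 hK5
    obtain ⟨a, rfl⟩ : 2 ∣ x := by
      have x8 := sq_mod_eight x
      omega
    have h2 : 3 * (p : ℤ) = 2 * a ^ 2 + 5 * y ^ 2 := by linarith
    have a8 := sq_mod_eight a
    have y8 := sq_mod_eight y
    clear hK
    omega
  · clear x5 hp5 hK5
    have x3 := sq_mod_three x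
    have y3 := sq_mod_three y
    obtain ⟨a, rfl⟩ : 3 ∣ x := by omega
    obtain ⟨b, rfl⟩ : 3 ∣ y := by omega
    exact ⟨a, b, by linarith⟩
  · have x8 := sq_mod_eight x
    obtain ⟨a, rfl⟩ : 10 ∣ x := by
      have h2 : 2 ∣ x := by clear x5 hp5 hK5; omega
      have h5 : 5 ∣ x := by clear x8; omega
      omega
    exact ⟨y, a, by linarith⟩

end RepresentationByForm

/-! ### Evaluation modulo 5 and removal of the sign conditions. -/

section OcticSymbol

theorem neg_one_zpow_congr {K : Type*} [Field K] {m n : ℤ} (h : 2 ∣ m - n) :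
    (-1 : K) ^ m = (-1) ^ n := by
  rw [← sub_add_cancel m n, zpow_add₀ (by simp), Even.neg_one_zpow (even_iff_two_dvd.mpr h),
    one_mul]

theorem neg_one_zpow_congr_add_one {K : Type*} [Field K] {m n : ℤ} (h : 2 ∣ m - n - 1) :
    (-1 : K) ^ m = -(-1) ^ n := by
  rw [neg_one_zpow_congr (n := n + 1) (by rwa [← sub_sub]), zpow_add_one₀ (by simp), mul_neg_one]

theorem quarticJacobi_five_one_add_I : quarticJacobi 5 ⟨1, 1⟩ = 1 := by
  rw [quarticJacobi_one_add_I (by norm_num)]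
  rfl

theorem quarticJacobi_five_I : quarticJacobi 5 ⟨0, 1⟩ = 2 := by
  rw [quarticJacobi_prime (by norm_num), primeSymbol_eq, quarticSymbol_I (by norm_num)]
  rfl

theorem quarticJacobi_five_I_sub_one : quarticJacobi 5 ⟨-1, 1⟩ = 3 := by
  rw [show (⟨-1, 1⟩ : GaussianInt) = ⟨0, 1⟩ * ⟨1, 1⟩ by decide, quarticJacobi_mul (by norm_num),
    quarticJacobi_five_I, quarticJacobi_five_one_add_I]
  · rfl
  · rw [norm_I]; exact isCoprime_one_right
  · rw [norm_one_add_I]; exact ⟨1, -2, by norm_num⟩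

open SplitPrime in
theorem quarticJacobi_five {a b x u v : ℤ} (hx : ¬ 5 ∣ x) (huv : IsCoprime 5 (u ^ 2 + v ^ 2))
    (ha : 5 ∣ a - x * u) (hb : 5 ∣ b - x * v) :
    quarticJacobi 5 ⟨a, b⟩ = quarticJacobi 5 ⟨u, v⟩ := by
  have h5 : IsCoprime 5 x := by
    have := Nat.prime_iff_prime_int.mp Nat.prime_five
    exact (this.coprime_iff_not_dvd).mpr (by exact_mod_cast hx)
  refine Eq.trans ?_ (quarticJacobi_smul (n := 5) (g := x) (by norm_num) h5 huv)
  exact quarticJacobi_congr (by simpa using ha) (by simpa using hb)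

variable {p : ℕ} [Fact p.Prime] {c d x y : ℤ}

/-- The octic symbol of `-5` when `x ≡ 1 (mod 4)`, in the cases where the descent applies. -/
theorem neg_five_pow_of_one_mod_four (h8 : p % 8 = 1) (hc : c % 4 = 1) (hd : 4 ∣ d)
    (hcd : (p : ℤ) = c ^ 2 + d ^ 2) (hxy : (p : ℤ) = x ^ 2 + 10 * y ^ 2) (hx : x % 4 = 1)
    (hy : 2 ∣ y) (hx5 : ¬ 5 ∣ x) :
    (5 ∣ d → 5 ∣ x - c → (-5 : ZMod p) ^ ((p - 1) / 8) = (-1) ^ (d / 4 + y / 2)) ∧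
    (5 ∣ d → 5 ∣ x + c → (-5 : ZMod p) ^ ((p - 1) / 8) = -(-1) ^ (d / 4 + y / 2)) ∧
    (5 ∣ c → 5 ∣ x - d → (-5 : ZMod p) ^ ((p - 1) / 8) =
      -((-1) ^ (d / 4 + y / 2) * ((c : ZMod p) / (d : ZMod p)))) := by
  let π : SplitPrime := ⟨p, inferInstance, c, d, hcd, by omega⟩
  have main := fun h => SplitPrime.neg_five_pow (π := π) h8 hc hd hxy hx hy h
  have hI : π.imag * π.imag = -1 := π.imag_mul_self
  have key : ∀ j : ZMod 4, π.imag ^ (j + 2 * (d / 4 : ℤ) + 2 * (y / 2 : ℤ)).val =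
      π.imag ^ j.val * (-1) ^ (d / 4 + y / 2) := by
    intro j
    have e : j + 2 * (d / 4 : ℤ) + 2 * (y / 2 : ℤ) = j + ((2 * (d / 4 + y / 2) : ℤ) : ZMod 4) := by
      push_cast; ring
    rw [e, pow_val_add hI, pow_val_intCast hI, zpow_mul, zpow_ofNat, pow_two, hI]
  refine ⟨fun h1 h2 => ?_, fun h1 h2 => ?_, fun h1 h2 => ?_⟩
  · have h := main (by rintro ⟨h3, -⟩; change 5 ∣ c at h3; omega)
    have hT : quarticJacobi 5 ⟨c, x + d⟩ = 1 := by
      rw [quarticJacobi_five (u := 1) (v := 1) hx5 ⟨1, -2, by norm_num⟩ (by omega) (by omega),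
        quarticJacobi_five_one_add_I]
    change _ = π.imag ^ (quarticJacobi 5 ⟨c, x + d⟩ - 1 + 2 * (d / 4 : ℤ) + 2 * (y / 2 : ℤ)).val at h
    rw [hT, key, show (1 - 1 : ZMod 4).val = 0 from rfl, pow_zero, one_mul] at h
    exact h
  · have h := main (by rintro ⟨h3, -⟩; change 5 ∣ c at h3; omega)
    have hT : quarticJacobi 5 ⟨c, x + d⟩ = 3 := by
      rw [quarticJacobi_five (u := -1) (v := 1) hx5 ⟨1, -2, by norm_num⟩ (by omega) (by omega),
        quarticJacobi_five_I_sub_one]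
    change _ = π.imag ^ (quarticJacobi 5 ⟨c, x + d⟩ - 1 + 2 * (d / 4 : ℤ) + 2 * (y / 2 : ℤ)).val at h
    rw [hT, key, show (3 - 1 : ZMod 4).val = 2 from rfl, pow_two, hI, neg_one_mul] at h
    exact h
  · have h := main (by rintro ⟨-, h3⟩; change 5 ∣ x + d at h3; omega)
    have hT : quarticJacobi 5 ⟨c, x + d⟩ = 2 := by
      -- Since c ≡ 0 and d ≡ x, c + (x+d)i ≡ 2x·i (mod 5).
      rw [quarticJacobi_five (x := 2 * x) (u := 0) (v := 1) (by omega) ⟨0, 1, by norm_num⟩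
        (by omega) (by omega), quarticJacobi_five_I]
    change _ = π.imag ^ (quarticJacobi 5 ⟨c, x + d⟩ - 1 + 2 * (d / 4 : ℤ) + 2 * (y / 2 : ℤ)).val at h
    rw [hT, key, show (2 - 1 : ZMod 4).val = 1 from rfl, pow_one] at h
    refine h.trans ?_
    -- The image of i in the residue field is -c/d by definition.
    change (-(c : ZMod p) / d) * _ = _
    ring

/-- Replacing x by -x exchanges the two cases and flips the parity of (x-1)/2, so x ≡ 3 (mod 4)
reduces to x ≡ 1. -/
theorem neg_five_pow_of_two_mod_five (h8 : p % 8 = 1) (hc : c % 4 = 1) (hd : 4 ∣ d)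
    (hcd : (p : ℤ) = c ^ 2 + d ^ 2) (hxy : (p : ℤ) = x ^ 2 + 10 * y ^ 2) (hx : x % 2 = 1)
    (hy : 2 ∣ y) (hx5 : ¬ 5 ∣ x) (hd5 : 5 ∣ d) :
    (5 ∣ x - c → (-5 : ZMod p) ^ ((p - 1) / 8) = (-1) ^ (d / 4 + (x - 1) / 2 + y / 2)) ∧
    (5 ∣ x + c → (-5 : ZMod p) ^ ((p - 1) / 8) = -(-1) ^ (d / 4 + (x - 1) / 2 + y / 2)) := by
  rcases (by omega : x % 4 = 1 ∨ (-x) % 4 = 1) with h | h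
  · obtain ⟨h1, h2, -⟩ := neg_five_pow_of_one_mod_four h8 hc hd hcd hxy h hy hx5
    rw [neg_one_zpow_congr (n := d / 4 + y / 2) (by omega)]
    exact ⟨h1 hd5, h2 hd5⟩
  · obtain ⟨h1, h2, -⟩ := neg_five_pow_of_one_mod_four (x := -x) h8 hc hd hcd
      (by rw [hxy]; ring) h hy (by omega)
    rw [neg_one_zpow_congr_add_one (n := d / 4 + y / 2) (by omega), neg_neg]
    exact ⟨fun h5 => h2 hd5 (by omega), fun h5 => h1 hd5 (by omega)⟩

theorem neg_five_pow_of_one_mod_five (h8 : p % 8 = 1) (hc : c % 4 = 1) (hd : 4 ∣ d)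
    (hcd : (p : ℤ) = c ^ 2 + d ^ 2) (hxy : (p : ℤ) = x ^ 2 + 10 * y ^ 2) (hx : x % 2 = 1)
    (hy : 2 ∣ y) (hx5 : ¬ 5 ∣ x) (hc5 : 5 ∣ c) (hxd : 5 ∣ x - d) :
    (-5 : ZMod p) ^ ((p - 1) / 8) =
      -((-1) ^ (d / 4 + (x - 1) / 2 + y / 2) * ((c : ZMod p) / (d : ZMod p))) := by
  rcases (by omega : x % 4 = 1 ∨ (-x) % 4 = 1) with h | h
  · obtain ⟨-, -, h3⟩ := neg_five_pow_of_one_mod_four h8 hc hd hcd hxy h hy hx5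
    rw [neg_one_zpow_congr (n := d / 4 + y / 2) (by omega)]
    exact h3 hc5 hxd
  -- Negating d together with x preserves x ≡ d (mod 5); the sign of c/d compensates the change in
  -- (x-1)/2.
  · obtain ⟨-, -, h3⟩ := neg_five_pow_of_one_mod_four (x := -x) (d := -d) h8 hc (by omega)
      (by rw [hcd]; ring) (by rw [hxy]; ring) h hy (by omega)
    rw [neg_one_zpow_congr_add_one (n := -d / 4 + y / 2) (by omega), h3 hc5 (by omega)]
    push_cast
    rw [div_neg]
    ring

end OcticSymbol

theorem corollary4p5 (p : ℕ) [Fact p.Prime] (hp : p ≡ 1 [MOD 40] ∨ p ≡ 9 [MOD 40]) :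
    (∃ c d x y : ℤ, (p : ℤ) = c ^ 2 + d ^ 2 ∧ (p : ℤ) = x ^ 2 + 10 * y ^ 2) ∧
    ∀ (c d x y d₀ : ℤ) (r : ℕ),
      (p : ℤ) = c ^ 2 + d ^ 2 → (p : ℤ) = x ^ 2 + 10 * y ^ 2 →
      c ≡ 1 [ZMOD 4] → d = 2 ^ r * d₀ → d₀ ≡ 1 [ZMOD 4] →
      (Int.gcd c (x + d) = 1 ∨ Int.gcd d₀ (x + c) = 1) →
      -- all divisions in the exponent of `-1` below are exact, and both quotients are genuine
      (4 ∣ d ∧ 2 ∣ x - 1 ∧ 2 ∣ y ∧ ¬ (p : ℤ) ∣ d ∧ ¬ (5 : ℤ) ∣ x) ∧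
      ((2 * c - d : ZMod 5) / (x : ZMod 5) = 2 →
        (-5 : ZMod p) ^ ((p - 1) / 8) = (-1) ^ (d / 4 + (x - 1) / 2 + y / 2)) ∧
      ((2 * c - d : ZMod 5) / (x : ZMod 5) = -2 →
        (-5 : ZMod p) ^ ((p - 1) / 8) = -(-1) ^ (d / 4 + (x - 1) / 2 + y / 2)) ∧
      ((2 * c - d : ZMod 5) / (x : ZMod 5) = 1 →
        (-5 : ZMod p) ^ ((p - 1) / 8) =
          (-1) ^ (d / 4 + (x - 1) / 2 + y / 2) * ((c : ZMod p) / (d : ZMod p))) ∧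
      ((2 * c - d : ZMod 5) / (x : ZMod 5) = -1 →
        (-5 : ZMod p) ^ ((p - 1) / 8) =
          -((-1) ^ (d / 4 + (x - 1) / 2 + y / 2) * ((c : ZMod p) / (d : ZMod p)))) := by
  have h40 : p % 40 = 1 ∨ p % 40 = 9 := hp
  have h8 : p % 8 = 1 := by omega
  refine ⟨?_, ?_⟩
  · obtain ⟨x, y, hxy⟩ := exists_eq_sq_add_ten_mul_sq hp
    obtain ⟨c, d, hcd⟩ := Nat.Prime.sq_add_sq (p := p) (by omega)
    exact ⟨c, d, x, y, by exact_mod_cast hcd.symm, hxy⟩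
  intro c d x y d₀ r hcd hxy hc _ _ _
  have hc4 : c % 4 = 1 := hc
  have c8 := sq_mod_eight c
  have d8 := sq_mod_eight d
  have x8 := sq_mod_eight x
  have y8 := sq_mod_eight y
  have x5 := sq_mod_five x
  have hd4 : 4 ∣ d := by
    obtain ⟨m, rfl⟩ : 2 ∣ d := by omega
    have m8 := sq_mod_eight m
    have : (2 * m) ^ 2 = 4 * m ^ 2 := by ring
    omega
  have hx2 : x % 2 = 1 := by omega
  have hy2 : 2 ∣ y := by omega
  have hx5 : ¬ (5 : ℤ) ∣ x := by
    rintro ⟨m, rfl⟩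
    have : (5 * m) ^ 2 = 5 * (5 * m ^ 2) := by ring
    omega
  have hpd : ¬ (p : ℤ) ∣ d := by
    rw [← ZMod.intCast_zmod_eq_zero_iff_dvd]
    exact SplitPrime.b_ne_zero ⟨p, inferInstance, c, d, hcd, by omega⟩
  refine ⟨⟨hd4, by omega, hy2, hpd, hx5⟩, ?_⟩
  have hx0 : (x : ZMod 5) ≠ 0 := by
    rw [Ne, ZMod.intCast_zmod_eq_zero_iff_dvd]
    exact_mod_cast hx5
  have hrel : (c : ZMod 5) ^ 2 + (d : ZMod 5) ^ 2 = (x : ZMod 5) ^ 2 := by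
    have h := congrArg (Int.cast (R := ZMod 5)) (hcd.symm.trans hxy)
    push_cast at h
    rw [h, show (10 : ZMod 5) = 0 from rfl, zero_mul, add_zero]
  have dvd_iff : ∀ n : ℤ, (n : ZMod 5) = 0 ↔ 5 ∣ n := fun n => by
    rw [ZMod.intCast_zmod_eq_zero_iff_dvd]; norm_cast
  -- Over 𝔽₅ the circle c² + d² = x² consists of (c, d) = (±x, 0), (0, ±x), and (2c-d)/x separates
  -- these four points.
  refine ⟨fun h => ?_, fun h => ?_, fun h => ?_, fun h => ?_⟩
  · rw [div_eq_iff hx0] at h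
    have key : ∀ c d x : ZMod 5, x ≠ 0 → c ^ 2 + d ^ 2 = x ^ 2 → 2 * c - d = 2 * x →
        d = 0 ∧ x - c = 0 := by decide
    obtain ⟨h1, h2⟩ := key _ _ _ hx0 hrel h
    rw [← Int.cast_sub] at h2
    exact (neg_five_pow_of_two_mod_five h8 hc4 hd4 hcd hxy hx2 hy2 hx5 ((dvd_iff _).mp h1)).1
      ((dvd_iff _).mp h2)
  · rw [div_eq_iff hx0] at h
    have key : ∀ c d x : ZMod 5, x ≠ 0 → c ^ 2 + d ^ 2 = x ^ 2 → 2 * c - d = -2 * x →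
        d = 0 ∧ x + c = 0 := by decide
    obtain ⟨h1, h2⟩ := key _ _ _ hx0 hrel h
    rw [← Int.cast_add] at h2
    exact (neg_five_pow_of_two_mod_five h8 hc4 hd4 hcd hxy hx2 hy2 hx5 ((dvd_iff _).mp h1)).2
      ((dvd_iff _).mp h2)
  · rw [div_eq_iff hx0] at h
    have key : ∀ c d x : ZMod 5, x ≠ 0 → c ^ 2 + d ^ 2 = x ^ 2 → 2 * c - d = 1 * x →
        c = 0 ∧ x + d = 0 := by decide
    obtain ⟨h1, h2⟩ := key _ _ _ hx0 hrel h
    rw [← Int.cast_add] at h2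
    -- Here x ≡ -d and 5 divides both c and x+d; passing to -d makes the gcd prime to 5 and changes
    -- the sign of c/d.
    have h3 := neg_five_pow_of_one_mod_five (d := -d) h8 hc4 (by omega) (by rw [hcd]; ring) hxy hx2
      hy2 hx5 ((dvd_iff _).mp h1) (by rw [sub_neg_eq_add]; exact (dvd_iff _).mp h2)
    rw [h3, neg_one_zpow_congr (n := d / 4 + (x - 1) / 2 + y / 2) (by omega)]
    push_cast
    rw [div_neg]
    ring
  · rw [div_eq_iff hx0] at h
    have key : ∀ c d x : ZMod 5, x ≠ 0 → c ^ 2 + d ^ 2 = x ^ 2 → 2 * c - d = -1 * x →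
        c = 0 ∧ x - d = 0 := by decide
    obtain ⟨h1, h2⟩ := key _ _ _ hx0 hrel h
    rw [← Int.cast_sub] at h2
    exact neg_five_pow_of_one_mod_five h8 hc4 hd4 hcd hxy hx2 hy2 hx5 ((dvd_iff _).mp h1)
      ((dvd_iff _).mp h2)
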